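/- \textbf{Setting.} Let $a>0$, $\tau\ge 6$, $m\ge 10$ and $N\ge 1$ be given ($m,N$ integers), let $V_0=(-a,a)^2$, and let $S\in L^2(\mathbb R^2)$ be supported in $V_0$. Put $k_0=\frac{\pi}{30a}$ and let $k$ belong to $$\mathbb K_N=\Big\{\tfrac{\pi}{a}|\boldsymbol l| : \boldsymbol l\in\mathbb Z^2,\ 1\le|\boldsymbol l|_\infty\le N\Big\}\cup\{k_0\}.$$ Let $\Phi_k(x,y)=\frac{\mathrm i}{8k^2}\big(H_0^{(1)}(k|x-y|)-H_0^{(1)}(\mathrm ik|x-y|)\big)$ be the outgoing fundamental solution of $\Delta^2-k^4$ in $\mathbb R^2$, and let $u(x,k)=\int_{V_0}\Phi_k(x,y)S(y)\,\mathrm dy$ be the field radiated by $S$. Choose $$\lambda_1=\tfrac12,\qquad R=\tau a,\ \ \lambda_2=\tfrac12+\tfrac{\pi}{2kR}\ \text{ if } k\ne k_0,\qquad R=6a,\ \ \lambda_2=-\tfrac32\ \text{ if } k=k_0 .$$ With $\vartheta_i=i\pi/m$ put, for $j=1,\dots,m$ and $\ell=1,2$, $$\Gamma_j=\{R(\cos\vartheta,\sin\vartheta):\vartheta_{2j-2}\le\vartheta\le\vartheta_{2j}\},\qquad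 z_{j,\ell}=\lambda_\ell R(\cos\vartheta_{2j-1},\sin\vartheta_{2j-1}),$$ $\|\cdot\|_{j,\infty}=\|\cdot\|_{L^\infty(\Gamma_j)}$, $u_{j,k}=u(\cdot,k)|_{\Gamma_j}$ and $c_{j,\ell,k}=\|u_{j,k}\|_{j,\infty}/\|\Phi_k(\cdot,z_{j,\ell})\|_{j,\infty}$. For $x\in\Gamma_j$ and $r_{j,\ell}=|x-z_{j,\ell}|$ let $$A_{j,\ell,k}=\tfrac1{k^2}\big(Y_0(kr_{j,\ell})+\mathrm iH_0^{(1)}(\mathrm ikr_{j,\ell})\big),\qquad B_{j,\ell,k}=-\tfrac1{k^2}J_0(kr_{j,\ell}).$$ \textbf{Noisy data and retrieved field.} Let $\varepsilon\in(0,1)$, and let the measured moduli $p,q_1,q_2:\Gamma_j\to[0,\infty)$ satisfy $$\big\|p-|u_{j,k}|\big\|_{j,\infty}\le\varepsilon\|u_{j,k}\|_{j,\infty},\qquad \big\|q_\ell-|\hat v_{j,\ell,k}|\big\|_{j,\infty}\le\varepsilon\|\hat v_{j,\ell,k}\|_{j,\infty}\quad(\ell=1,2),$$ where $c^\varepsilon_{j,\ell,k}=\|p\|_{j,\infty}/\|\Phi_k(\cdot,z_{j,\ell})\|_{j,\infty}$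 and $\hat v_{j,\ell,k}=u_{j,k}-c^\varepsilon_{j,\ell,k}\Phi_k(\cdot,z_{j,\ell})$. The retrieved field $u^\varepsilon_{j,k}$ is the solution, at each point of $\Gamma_j$, of the linear system $$A_{j,\ell,k}\,\Re u^\varepsilon_{j,k}+B_{j,\ell,k}\,\Im u^\varepsilon_{j,k}=\frac{4}{c^\varepsilon_{j,\ell,k}}\big(q_\ell^2-p^2\big)-\frac{c^\varepsilon_{j,\ell,k}}{16}\big(A_{j,\ell,k}^2+B_{j,\ell,k}^2\big),\qquad \ell=1,2$$ (with the convention $4/0=0$, needed only if $u_{j,k}$ vanishes almost everywhere on $\Gamma_j$). \textbf{Theorem.} For each $j=1,\dots,m$ one has $\|u_{j,k}\|_{j,\infty}<\infty$, the system is uniquely solvable at every point of $\Gamma_j$, and $$\|u^\varepsilon_{j,k}-u_{j,k}\|_{j,\infty}\le C_\varepsilon\,\|u_{j,k}\|_{j,\infty},\qquad C_\varepsilon=\frac{\sqrt2\,\varepsilon\,\eta_\varepsilon}{M},$$ where $$M=\frac12\Big(1.74-\frac{3}{2\tau}\Big),\qquad \eta_\varepsilon=\frac{4(3+\varepsilon)(2+\varepsilon)^2+4(3+\varepsilon)+8}{1-\varepsilon}+4\,(c_{j,1,k}+c_{j,2,k}).$$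 -/

import Mathlib

open Real Set MeasureTheory
open scoped ENNReal

/-- The plane `ℝ²` with its Euclidean norm. -/
abbrev Plane : Type := EuclideanSpace ℝ (Fin 2)

noncomputable section

namespace PhaseRetrieval

/-! ### Bessel and Hankel functions of order zero -/

/-- Bessel function of the first kind, `J₀(z) = ∑ₙ (-1)ⁿ (z²/4)ⁿ / (n!)²`. -/
def besselJ0 (z : ℂ) : ℂ :=
  ∑' n : ℕ, (-1 : ℂ) ^ n / ((n.factorial : ℂ) ^ 2) * (z ^ 2 / 4) ^ n

/-- Bessel function of the second kind (principal branch),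
`Y₀(z) = (2/π) (log (z/2) + γ) J₀(z) - (2/π) ∑ₙ (-1)ⁿ hₙ (z²/4)ⁿ / (n!)²`,
where `γ` is Euler's constant and `hₙ = 1 + 1/2 + ⋯ + 1/n`. -/
def besselY0 (z : ℂ) : ℂ :=
  2 / (π : ℂ) * (Complex.log (z / 2) + (Real.eulerMascheroniConstant : ℂ)) * besselJ0 z
    - 2 / (π : ℂ) *
      ∑' n : ℕ, (-1 : ℂ) ^ n * ((harmonic n : ℚ) : ℂ) / ((n.factorial : ℂ) ^ 2) * (z ^ 2 / 4) ^ n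

/-- Hankel function of the first kind, `H₀⁽¹⁾ = J₀ + i Y₀`. -/
def hankelH0 (z : ℂ) : ℂ := besselJ0 z + Complex.I * besselY0 z

/-- `Φ_k(x, y) = i/(8k²) (H₀⁽¹⁾(k|x-y|) - H₀⁽¹⁾(ik|x-y|))`, the outgoing fundamental solution
of `Δ² - k⁴` in the plane. -/
def fundSol (k : ℝ) (x y : Plane) : ℂ :=
  Complex.I / (8 * (k : ℂ) ^ 2) *
    (hankelH0 ((k * dist x y : ℝ) : ℂ) - hankelH0 (Complex.I * ((k * dist x y : ℝ) : ℂ)))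

/-! ### The radiated field -/

/-- The square `V₀ = (-a, a) × (-a, a)`. -/
def square (a : ℝ) : Set Plane := {x | ∀ i, x i ∈ Ioo (-a) a}

/-- The field `u(x, k) = ∫_{V₀} Φ_k(x, y) S(y) dy` radiated by the source `S`. -/
def field (a k : ℝ) (S : Plane → ℂ) (x : Plane) : ℂ :=
  ∫ y in square a, fundSol k x y * S y

/-! ### Wave numbers, parameters and geometry -/

/-- The small wave number `k₀ = π / (30 a)`. -/
def smallWaveNumber (a : ℝ) : ℝ := π / (30 * a)

/-- The admissible wave numbers `(π/a)|l|`, `l ∈ ℤ²`, `1 ≤ |l|_∞ ≤ N`, together with `k₀`. -/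
def admissible (a : ℝ) (N : ℕ) : Set ℝ :=
  {k | ∃ l₁ l₂ : ℤ, 1 ≤ max |l₁| |l₂| ∧ max |l₁| |l₂| ≤ (N : ℤ) ∧
      k = π / a * √((l₁ : ℝ) ^ 2 + (l₂ : ℝ) ^ 2)} ∪ {smallWaveNumber a}

/-- The observation radius: `6a` if `k = k₀`, and `τa` otherwise. -/
def radius (a τ k : ℝ) : ℝ := if k = smallWaveNumber a then 6 * a else τ * a

/-- The ratios `λ_{j,ℓ}`, `ℓ = 1, 2` (indexed here by `0, 1`); they do not depend on `j`. -/
def ratio (a τ k : ℝ) : Fin 2 → ℝ :=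
  ![1 / 2, if k = smallWaveNumber a then -3 / 2 else 1 / 2 + π / (2 * k * radius a τ k)]

/-- The angles `ϑ_i = iπ/m`. -/
def gridAngle (m : ℕ) (i : ℤ) : ℝ := i * π / m

/-- The point `ρ (cos ϑ, sin ϑ)`. -/
def polar (ρ ϑ : ℝ) : Plane := !₂[ρ * Real.cos ϑ, ρ * Real.sin ϑ]

/-- The arc `Γ_j = {R (cos ϑ, sin ϑ) : ϑ_{2j-2} ≤ ϑ ≤ ϑ_{2j}}`. -/
def arc (R : ℝ) (m j : ℕ) : Set Plane :=
  polar R '' Icc (gridAngle m (2 * j - 2)) (gridAngle m (2 * j))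

/-- The auxiliary source points `z_{j,ℓ} = λ_{j,ℓ} R (cos ϑ_{2j-1}, sin ϑ_{2j-1})`. -/
def sourcePoint (a τ k : ℝ) (m j : ℕ) (l : Fin 2) : Plane :=
  polar (ratio a τ k l * radius a τ k) (gridAngle m (2 * j - 1))

/-- The norm of `L^∞(Γ)`, with respect to arc length on the curve `Γ`. -/
def supNorm {F : Type*} [NormedAddCommGroup F] (Γ : Set Plane) (f : Plane → F) : ℝ≥0∞ :=
  eLpNorm f ∞ ((Measure.hausdorffMeasure 1).restrict Γ)

/-- The scaling factor `‖f‖_{L^∞(Γ)} / ‖Φ_k(·, z)‖_{L^∞(Γ)}`. -/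
def scaling {F : Type*} [NormedAddCommGroup F] (k : ℝ) (Γ : Set Plane) (z : Plane)
    (f : Plane → F) : ℝ :=
  (supNorm Γ f).toReal / (supNorm Γ (fun x => fundSol k x z)).toReal

/-! ### The phase retrieval system -/

/-- `A = (Y₀(kr) + H₀(kr)) / k²`, where `r = |x - z|` and `H₀(t) = i H₀⁽¹⁾(it)`; the quantity in
brackets is real, and the real part only turns it into an element of `ℝ`. -/
def coeffA (k : ℝ) (z x : Plane) : ℝ :=
  1 / k ^ 2 * (besselY0 ((k * dist x z : ℝ) : ℂ)
    + Complex.I * hankelH0 (Complex.I * ((k * dist x z : ℝ) : ℂ))).re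

/-- `B = - J₀(kr) / k²`, where `r = |x - z|`. -/
def coeffB (k : ℝ) (z x : Plane) : ℝ :=
  -(1 / k ^ 2) * (besselJ0 ((k * dist x z : ℝ) : ℂ)).re

/-- The right-hand side `(4/c) (q² - p²) - (c/16) (A² + B²)` built from the measured modulus `p` of
the field at `x`, the measured modulus `q` of the field with a point source at `z` added, and the
scaling factor `c`. -/
def rhs (k : ℝ) (z x : Plane) (c p q : ℝ) : ℝ :=
  4 / c * (q ^ 2 - p ^ 2) - c / 16 * (coeffA k z x ^ 2 + coeffB k z x ^ 2)

/-- `w` solves the phase retrieval system at the point `x`, with source points `z ℓ`, scaling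
factors `c ℓ` and measured moduli `p`, `q ℓ`. -/
def SolvesAt (k : ℝ) (z : Fin 2 → Plane) (x : Plane) (c : Fin 2 → ℝ) (p : ℝ) (q : Fin 2 → ℝ)
    (w : ℂ) : Prop :=
  ∀ l, coeffA k (z l) x * w.re + coeffB k (z l) x * w.im = rhs k (z l) x (c l) p (q l)

/-- `M = (1/2) (1.74 - 3/(2τ))`. -/
def constM (τ : ℝ) : ℝ := 1 / 2 * (1.74 - 3 / (2 * τ))

/-- `η_ε`, where `c₁`, `c₂` are the scaling factors of the exact field. -/
def eta (ε c₁ c₂ : ℝ) : ℝ :=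
  1 / (1 - ε) * (4 * (3 + ε) * (2 + ε) ^ 2 + 4 * (3 + ε) + 8) + 4 * (c₁ + c₂)

/-- `C_ε = √2 ε η_ε / M`. -/
def stabConst (τ ε c₁ c₂ : ℝ) : ℝ := √2 * ε * eta ε c₁ c₂ / constM τ

/-- `p` and `q ℓ` are measured moduli, with relative noise level `ε`, of the field `u` on `Γ` and
of the fields `u - c^ε_ℓ Φ_k(·, z_ℓ)`, where `c^ε_ℓ` is the scaling factor computed from `p`. -/
structure IsNoisyData (k ε : ℝ) (Γ : Set Plane) (z : Fin 2 → Plane) (u : Plane → ℂ)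
    (p : Plane → ℝ) (q : Fin 2 → Plane → ℝ) : Prop where
  nonneg_field : ∀ x ∈ Γ, 0 ≤ p x
  nonneg_aux : ∀ l, ∀ x ∈ Γ, 0 ≤ q l x
  noise_field : supNorm Γ (fun x => p x - ‖u x‖) ≤ ENNReal.ofReal ε * supNorm Γ u
  noise_aux : ∀ l,
    supNorm Γ (fun x => q l x - ‖u x - (scaling k Γ (z l) p : ℂ) * fundSol k x (z l)‖) ≤
      ENNReal.ofReal ε *
        supNorm Γ (fun x => u x - (scaling k Γ (z l) p : ℂ) * fundSol k x (z l))

end PhaseRetrieval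

end

/-!
Since `Φ_k(·, z) = -(A + iB) / 8`, expanding `|u - c Φ_k(·, z)|² - |u|²` shows that the exact moduli
determine the real linear form `A Re u + B Im u`, so two source points give a `2 × 2` system for
`u`. By Cramer's rule the error is controlled once the determinant is bounded below by a fixed
multiple of the product of the sup norms of the two point sources; the right-hand sides are
quadratic in the moduli, hence perturbed by `O(ε)` relative to the same norms.

Up to the factor `k⁻⁴`, the determinant is the cross product at `s = k r₁` and `t = k r₂` of `J₀`
and `Y₀ + (2/π) K₀`. For `k ≠ k₀` both arguments are large: `√t J₀(t)` and `√t Y₀(t)` solve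
`w'' + (1 + 1 / (4 t²)) w = 0`, so their cross product differs little from `(2/π) sin (t - s)`,
while the `K₀` terms are negligible. The choice of `λ₂` makes `kR/2` and `kR/2 - π/2` the distances
along the axis of the arc, which keeps `|t - s|` between `1.15` and `π/2`. For `k = k₀` both
arguments are at most `π/2` and the power series with four terms suffice.
-/

noncomputable section

namespace PhaseRetrieval

/-! ### Entire power series -/

/-- The sum of the power series with real coefficients `a`. -/
def powerSum (a : ℕ → ℝ) (y : ℝ) : ℝ := ∑' n, a n * y ^ n

/-- The power series with coefficients `a` converges on the whole line. -/
def IsEntireCoeff (a : ℕ → ℝ) : Prop := ∀ y : ℝ, Summable fun n => a n * y ^ n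

/-- Coefficients of the derivative `∑ aₙ₊₁ (n + 1) yⁿ`. -/
def derivCoeff (a : ℕ → ℝ) (n : ℕ) : ℝ := (n + 1) * a (n + 1)

/-- Coefficients of the image `∑ n aₙ yⁿ` under the Euler operator `y d/dy`. -/
def eulerCoeff (a : ℕ → ℝ) (n : ℕ) : ℝ := n * a n

section PowerSum

variable {a b : ℕ → ℝ}

theorem powerSum_zero (a : ℕ → ℝ) : powerSum a 0 = a 0 := by
  rw [powerSum, tsum_eq_single 0 fun n hn => by simp [hn]]
  simp

theorem IsEntireCoeff.hasSum (ha : IsEntireCoeff a) (y : ℝ) :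
    HasSum (fun n => a n * y ^ n) (powerSum a y) :=
  (ha y).hasSum

theorem IsEntireCoeff.of_abs_le (hb : IsEntireCoeff b) (h : ∀ n, |a n| ≤ b n) :
    IsEntireCoeff a := fun y => by
  refine .of_norm_bounded (hb |y|) fun n => ?_
  rw [Real.norm_eq_abs, abs_mul, abs_pow]
  gcongr
  exact h n

theorem IsEntireCoeff.euler (ha : IsEntireCoeff a) : IsEntireCoeff (eulerCoeff a) := fun y => by
  refine .of_norm_bounded (ha (2 * y)).norm fun n => ?_
  have hn : (n : ℝ) ≤ 2 ^ n := by exact_mod_cast n.lt_two_pow_self.le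
  simp only [eulerCoeff, Real.norm_eq_abs, abs_mul, abs_pow, Nat.abs_cast, Nat.abs_ofNat, mul_pow]
  calc n * |a n| * |y| ^ n ≤ 2 ^ n * |a n| * |y| ^ n := by gcongr
    _ = |a n| * (2 ^ n * |y| ^ n) := by ring

theorem IsEntireCoeff.deriv (ha : IsEntireCoeff a) : IsEntireCoeff (derivCoeff a) := fun y => by
  refine .of_norm_bounded ((summable_nat_add_iff 1).2 (ha.euler (|y| + 1)).norm) fun n => ?_
  have hy : |y| ^ n ≤ (|y| + 1) ^ (n + 1) :=
    (pow_le_pow_left₀ (abs_nonneg y) (by linarith) n).trans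
      (pow_le_pow_right₀ (by linarith [abs_nonneg y]) n.le_succ)
  simp only [derivCoeff, eulerCoeff, norm_mul, norm_pow, Real.norm_eq_abs, Nat.cast_add,
    Nat.cast_one, abs_of_nonneg (add_nonneg (abs_nonneg y) zero_le_one)]
  gcongr

theorem IsEntireCoeff.powerSum_add (ha : IsEntireCoeff a) (hb : IsEntireCoeff b) (y : ℝ) :
    powerSum (a + b) y = powerSum a y + powerSum b y := by
  rw [powerSum, powerSum, powerSum, ← (ha y).tsum_add (hb y)]
  simp only [Pi.add_apply, add_mul]

theorem IsEntireCoeff.mul_powerSum_deriv (ha : IsEntireCoeff a) (y : ℝ) :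
    y * powerSum (derivCoeff a) y = powerSum (eulerCoeff a) y := by
  rw [powerSum, powerSum, (ha.euler y).tsum_eq_zero_add, ← tsum_mul_left]
  simp only [eulerCoeff, derivCoeff, Nat.cast_zero, zero_mul, zero_add, Nat.cast_succ]
  exact tsum_congr fun n => by ring

theorem IsEntireCoeff.hasDerivAt_powerSum (ha : IsEntireCoeff a) (y : ℝ) :
    HasDerivAt (powerSum a) (powerSum (derivCoeff a) y) y := by
  set r := |y| + 1
  have hsum : Summable fun n : ℕ => |a n| * (n * r ^ (n - 1)) := by
    refine (summable_nat_add_iff 1).1 ((ha.deriv r).abs.congr fun n => ?_)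
    rw [derivCoeff, abs_mul, abs_mul, abs_of_nonneg (by positivity : (0 : ℝ) ≤ n + 1),
      abs_of_nonneg (by positivity : 0 ≤ r ^ n), Nat.cast_succ, Nat.add_sub_cancel]
    ring
  have hbound (n : ℕ) (x : ℝ) (hx : x ∈ Metric.ball (0 : ℝ) r) :
      ‖a n * (n * x ^ (n - 1))‖ ≤ |a n| * (n * r ^ (n - 1)) := by
    have hxr : |x| ≤ r := (mem_ball_zero_iff.1 hx).le
    rw [Real.norm_eq_abs, abs_mul, abs_mul, abs_pow, Nat.abs_cast]
    gcongr
  have hy : y ∈ Metric.ball (0 : ℝ) r := by simp [r]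
  have hderiv := hasDerivAt_tsum_of_isPreconnected hsum Metric.isOpen_ball
    (convex_ball (0 : ℝ) r).isPreconnected
    (fun n x _ => (hasDerivAt_pow n x).const_mul (a n)) hbound hy (ha y) hy
  refine hderiv.congr_deriv ?_
  rw [(Summable.of_norm_bounded hsum fun n => hbound n y hy).tsum_eq_zero_add, powerSum]
  simp only [derivCoeff, Nat.cast_zero, zero_mul, mul_zero, zero_add, Nat.add_sub_cancel,
    Nat.cast_succ]
  exact tsum_congr fun n => by ring

theorem abs_powerSum_sub_partialSum_le {N : ℕ} {C y : ℝ}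
    (ha : ∀ n, |a (n + N)| ≤ C * (1 / 2) ^ n) (hy : |y| ≤ 1) :
    |powerSum a y - ∑ n ∈ Finset.range N, a n * y ^ n| ≤ 2 * C * |y| ^ N := by
  have htail (n : ℕ) : ‖a (n + N) * y ^ (n + N)‖ ≤ C * |y| ^ N * (1 / 2) ^ n := by
    rw [Real.norm_eq_abs, abs_mul, abs_pow, pow_add]
    calc |a (n + N)| * (|y| ^ n * |y| ^ N) ≤ C * (1 / 2) ^ n * (1 * |y| ^ N) := by
          gcongr
          · exact (abs_nonneg _).trans (ha n)
          · exact ha n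
          · exact pow_le_one₀ (abs_nonneg y) hy
      _ = C * |y| ^ N * (1 / 2) ^ n := by ring
  have hgeom : HasSum (fun n : ℕ => C * |y| ^ N * (1 / 2) ^ n) (C * |y| ^ N * 2) :=
    hasSum_geometric_two.mul_left _
  have hsum : Summable fun n => a n * y ^ n :=
    (summable_nat_add_iff N).1 (.of_norm_bounded hgeom.summable htail)
  rw [powerSum, ← hsum.sum_add_tsum_nat_add N, add_sub_cancel_left]
  calc |∑' n, a (n + N) * y ^ (n + N)| ≤ C * |y| ^ N * 2 := tsum_of_norm_bounded hgeom htail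
    _ = 2 * C * |y| ^ N := by ring

end PowerSum

/-- Coefficients `1 / (n!)²` of the regular solution of Bessel's equation, as a power series in
`σ t² / 4`. -/
def regCoeff (n : ℕ) : ℝ := 1 / (n.factorial : ℝ) ^ 2

/-- Coefficients `hₙ / (n!)²` of the non-logarithmic part of the second solution of Bessel's
equation, where `hₙ` is the `n`-th harmonic number. -/
def logCoeff (n : ℕ) : ℝ := (harmonic n : ℝ) / (n.factorial : ℝ) ^ 2

theorem harmonic_cast_nonneg (n : ℕ) : (0 : ℝ) ≤ harmonic n := by
  have : (0 : ℚ) ≤ harmonic n := Finset.sum_nonneg fun i _ => by positivity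
  exact_mod_cast this

theorem harmonic_succ_cast (n : ℕ) :
    (harmonic (n + 1) : ℝ) = harmonic n + 1 / ((n : ℝ) + 1) := by
  rw [harmonic_succ]
  push_cast
  ring

theorem harmonic_cast_le (n : ℕ) : (harmonic n : ℝ) ≤ n := by
  induction n with
  | zero => simp
  | succ n ih =>
    have : 1 / ((n : ℝ) + 1) ≤ 1 := div_le_one_of_le₀ (by simp) (by positivity)
    rw [harmonic_succ_cast, Nat.cast_succ]
    linarith

theorem regCoeff_pos (n : ℕ) : 0 < regCoeff n := by
  rw [regCoeff]
  positivity

theorem sq_mul_regCoeff_succ (n : ℕ) : ((n : ℝ) + 1) ^ 2 * regCoeff (n + 1) = regCoeff n := by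
  rw [regCoeff, regCoeff, Nat.factorial_succ]
  push_cast
  field_simp

theorem logCoeff_eq_harmonic_mul (n : ℕ) : logCoeff n = harmonic n * regCoeff n := by
  rw [logCoeff, regCoeff, mul_one_div]

theorem abs_logCoeff_le (n : ℕ) : |logCoeff n| ≤ eulerCoeff regCoeff n := by
  rw [logCoeff_eq_harmonic_mul, eulerCoeff, abs_of_nonneg
    (mul_nonneg (harmonic_cast_nonneg n) (regCoeff_pos n).le)]
  exact mul_le_mul_of_nonneg_right (harmonic_cast_le n) (regCoeff_pos n).le

theorem isEntireCoeff_regCoeff : IsEntireCoeff regCoeff := by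
  refine IsEntireCoeff.of_abs_le (b := fun n => 1 / n.factorial) (fun y => ?_) fun n => ?_
  · exact (Real.summable_pow_div_factorial y).congr fun n => by ring
  · have : (1 : ℝ) ≤ n.factorial := by exact_mod_cast n.factorial_pos
    rw [abs_of_pos (regCoeff_pos n), regCoeff]
    gcongr
    exact le_self_pow₀ this two_ne_zero

theorem isEntireCoeff_logCoeff : IsEntireCoeff logCoeff :=
  isEntireCoeff_regCoeff.euler.of_abs_le abs_logCoeff_le

theorem derivCoeff_eulerCoeff_regCoeff : derivCoeff (eulerCoeff regCoeff) = regCoeff := by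
  ext n
  rw [← sq_mul_regCoeff_succ, derivCoeff, eulerCoeff]
  push_cast
  ring

theorem derivCoeff_eulerCoeff_logCoeff :
    derivCoeff (eulerCoeff logCoeff) = logCoeff + derivCoeff regCoeff := by
  ext n
  simp only [Pi.add_apply, derivCoeff, eulerCoeff, logCoeff_eq_harmonic_mul, harmonic_succ_cast,
    Nat.cast_succ, ← sq_mul_regCoeff_succ n]
  field_simp

theorem hasDerivAt_powerSum_euler_regCoeff (y : ℝ) :
    HasDerivAt (powerSum (eulerCoeff regCoeff)) (powerSum regCoeff y) y := by
  simpa only [derivCoeff_eulerCoeff_regCoeff] using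
    isEntireCoeff_regCoeff.euler.hasDerivAt_powerSum y

theorem hasDerivAt_powerSum_euler_logCoeff (y : ℝ) :
    HasDerivAt (powerSum (eulerCoeff logCoeff))
      (powerSum logCoeff y + powerSum (derivCoeff regCoeff) y) y := by
  simpa only [derivCoeff_eulerCoeff_logCoeff,
    isEntireCoeff_logCoeff.powerSum_add isEntireCoeff_regCoeff.deriv] using
    isEntireCoeff_logCoeff.euler.hasDerivAt_powerSum y

theorem powerSum_wronskian (y : ℝ) :
    powerSum regCoeff y ^ 2 + 2 * (powerSum (eulerCoeff regCoeff) y * powerSum logCoeff y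
      - powerSum regCoeff y * powerSum (eulerCoeff logCoeff) y) = 1 := by
  have hderiv (y : ℝ) : HasDerivAt (fun y => powerSum regCoeff y ^ 2 +
      2 * (powerSum (eulerCoeff regCoeff) y * powerSum logCoeff y
        - powerSum regCoeff y * powerSum (eulerCoeff logCoeff) y)) 0 y := by
    have hreg := isEntireCoeff_regCoeff.hasDerivAt_powerSum y
    refine ((hreg.pow 2).add ((((hasDerivAt_powerSum_euler_regCoeff y).mul
      (isEntireCoeff_logCoeff.hasDerivAt_powerSum y)).sub
      (hreg.mul (hasDerivAt_powerSum_euler_logCoeff y))).const_mul 2)).congr_deriv ?_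
    rw [← isEntireCoeff_regCoeff.mul_powerSum_deriv, ← isEntireCoeff_logCoeff.mul_powerSum_deriv]
    push_cast
    ring
  have hconst := is_const_of_deriv_eq_zero (fun y => (hderiv y).differentiableAt)
    (fun y => (hderiv y).deriv) y 0
  simpa [powerSum_zero, regCoeff, logCoeff, eulerCoeff] using hconst

theorem regCoeff_add_three_le (n : ℕ) : regCoeff (n + 3) ≤ 1 / 36 * (1 / 2) ^ n := by
  induction n with
  | zero => norm_num [regCoeff, Nat.factorial]
  | succ n ih =>
    have hrec := sq_mul_regCoeff_succ (n + 3)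
    have hpos := regCoeff_pos (n + 3 + 1)
    have hfactor : (2 : ℝ) ≤ (((n + 3 : ℕ) : ℝ) + 1) ^ 2 := by
      push_cast
      nlinarith [n.cast_nonneg (α := ℝ)]
    rw [show n + 1 + 3 = n + 3 + 1 by ring, pow_succ]
    linarith [mul_le_mul_of_nonneg_right hfactor hpos.le]

theorem abs_powerSum_sub_cubic_le {a : ℕ → ℝ} {c y : ℝ}
    (ha : ∀ n, |a (n + 4)| ≤ c * (((n + 4 : ℕ) : ℝ) ^ 2 * regCoeff (n + 4))) (hy : |y| ≤ 1) :
    |powerSum a y - (a 0 + a 1 * y + a 2 * y ^ 2 + a 3 * y ^ 3)| ≤ c / 18 * y ^ 4 := by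
  have hc : 0 ≤ c := nonneg_of_mul_nonneg_left ((abs_nonneg _).trans (ha 0))
    (mul_pos (by norm_num) (regCoeff_pos _))
  have hcoeff (n : ℕ) : |a (n + 4)| ≤ c / 36 * (1 / 2) ^ n :=
    calc |a (n + 4)| ≤ c * regCoeff (n + 3) := by
          refine (ha n).trans_eq ?_
          rw [← sq_mul_regCoeff_succ (n + 3), Nat.cast_succ (n + 3)]
      _ ≤ c * (1 / 36 * (1 / 2) ^ n) := by
          gcongr
          exact regCoeff_add_three_le n
      _ = c / 36 * (1 / 2) ^ n := by ring
  convert abs_powerSum_sub_partialSum_le hcoeff hy using 1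
  · simp only [Finset.sum_range_succ, Finset.sum_range_zero, pow_zero, pow_one, mul_one, zero_add]
  · rw [Even.pow_abs (by decide)]
    ring

theorem euler_regCoeff_add_four_le (n : ℕ) :
    eulerCoeff regCoeff (n + 4) ≤ 1 / 4 * (((n + 4 : ℕ) : ℝ) ^ 2 * regCoeff (n + 4)) := by
  have : (0 : ℝ) ≤ n * (((n + 4 : ℕ) : ℝ) * regCoeff (n + 4)) :=
    mul_nonneg n.cast_nonneg (mul_nonneg (Nat.cast_nonneg _) (regCoeff_pos _).le)
  rw [eulerCoeff]
  push_cast at this ⊢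
  linarith

theorem abs_powerSum_regCoeff_sub_le {y : ℝ} (hy : |y| ≤ 1) :
    |powerSum regCoeff y - (1 + y + y ^ 2 / 4 + y ^ 3 / 36)| ≤ y ^ 4 / 288 := by
  convert abs_powerSum_sub_cubic_le (a := regCoeff) (c := 1 / 16) (fun n => ?_) hy using 1
  · congr 2
    norm_num [regCoeff, Nat.factorial]
    ring
  · ring
  · have hfactor : (16 : ℝ) ≤ ((n + 4 : ℕ) : ℝ) ^ 2 := by
      push_cast
      nlinarith [n.cast_nonneg (α := ℝ)]
    rw [abs_of_pos (regCoeff_pos _)]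
    linarith [mul_le_mul_of_nonneg_right hfactor (regCoeff_pos (n + 4)).le]

theorem abs_powerSum_logCoeff_sub_le {y : ℝ} (hy : |y| ≤ 1) :
    |powerSum logCoeff y - (y + 3 / 8 * y ^ 2 + 11 / 216 * y ^ 3)| ≤ y ^ 4 / 72 := by
  convert abs_powerSum_sub_cubic_le (a := logCoeff) (c := 1 / 4) (fun n => ?_) hy using 1
  · congr 2
    norm_num [logCoeff, Nat.factorial, harmonic, Finset.sum_range_succ]
  · ring
  · exact (abs_logCoeff_le _).trans (euler_regCoeff_add_four_le n)

theorem abs_powerSum_euler_regCoeff_sub_le {y : ℝ} (hy : |y| ≤ 1) :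
    |powerSum (eulerCoeff regCoeff) y - (y + y ^ 2 / 2 + y ^ 3 / 12)| ≤ y ^ 4 / 72 := by
  convert abs_powerSum_sub_cubic_le (a := eulerCoeff regCoeff) (c := 1 / 4) (fun n => ?_) hy
    using 1
  · congr 2
    norm_num [eulerCoeff, regCoeff, Nat.factorial]
    ring
  · ring
  · refine (abs_of_nonneg (mul_nonneg (Nat.cast_nonneg _) (regCoeff_pos _).le)).trans_le ?_
    exact euler_regCoeff_add_four_le n

theorem abs_powerSum_euler_logCoeff_sub_le {y : ℝ} (hy : |y| ≤ 1) :
    |powerSum (eulerCoeff logCoeff) y - (y + 3 / 4 * y ^ 2 + 11 / 72 * y ^ 3)| ≤ y ^ 4 / 18 := by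
  convert abs_powerSum_sub_cubic_le (a := eulerCoeff logCoeff) (c := 1) (fun n => ?_) hy using 1
  · congr 2
    norm_num [eulerCoeff, logCoeff, Nat.factorial, harmonic, Finset.sum_range_succ]
  · ring
  · rw [eulerCoeff, abs_mul, Nat.abs_cast, one_mul, sq, mul_assoc]
    gcongr
    exact abs_logCoeff_le _

/-! ### Real cylinder functions -/

/-- The solution of `(t w')' = σ t w` with `w 0 = 1`: this is `J₀` for `σ = -1` and `I₀` for
`σ = 1`. -/
def regSol (σ t : ℝ) : ℝ := powerSum regCoeff (σ * t ^ 2 / 4)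

/-- `t` times the derivative of `regSol σ`. -/
def regSolEuler (σ t : ℝ) : ℝ := 2 * powerSum (eulerCoeff regCoeff) (σ * t ^ 2 / 4)

/-- The logarithmic solution of `(t w')' = σ t w`: this is `(π / 2) Y₀` for `σ = -1` and `-K₀` for
`σ = 1`. -/
def logSol (σ t : ℝ) : ℝ :=
  (log (t / 2) + eulerMascheroniConstant) * regSol σ t - powerSum logCoeff (σ * t ^ 2 / 4)

/-- `t` times the derivative of `logSol σ`. -/
def logSolEuler (σ t : ℝ) : ℝ :=
  regSol σ t + (log (t / 2) + eulerMascheroniConstant) * regSolEuler σ t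
    - 2 * powerSum (eulerCoeff logCoeff) (σ * t ^ 2 / 4)

theorem hasDerivAt_comp_sq_scaled {f : ℝ → ℝ} {f' σ t : ℝ}
    (hf : HasDerivAt f f' (σ * t ^ 2 / 4)) :
    HasDerivAt (fun t => f (σ * t ^ 2 / 4)) (f' * (σ * t / 2)) t := by
  refine (hf.comp t (((hasDerivAt_pow 2 t).const_mul σ).div_const 4)).congr_deriv ?_
  push_cast
  ring

theorem hasDerivAt_regSol (σ : ℝ) {t : ℝ} (ht : t ≠ 0) :
    HasDerivAt (regSol σ) (regSolEuler σ t / t) t := by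
  refine (hasDerivAt_comp_sq_scaled
    (isEntireCoeff_regCoeff.hasDerivAt_powerSum (σ * t ^ 2 / 4))).congr_deriv ?_
  rw [regSolEuler, ← isEntireCoeff_regCoeff.mul_powerSum_deriv]
  field_simp
  ring

theorem hasDerivAt_regSolEuler (σ t : ℝ) :
    HasDerivAt (regSolEuler σ) (σ * t * regSol σ t) t := by
  refine ((hasDerivAt_comp_sq_scaled
    (hasDerivAt_powerSum_euler_regCoeff (σ * t ^ 2 / 4))).const_mul 2).congr_deriv ?_
  rw [regSol]
  ring

theorem hasDerivAt_log_half_add {t : ℝ} (ht : t ≠ 0) (c : ℝ) :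
    HasDerivAt (fun t : ℝ => log (t / 2) + c) (1 / t) t := by
  refine ((((hasDerivAt_id t).div_const 2).log (div_ne_zero ht two_ne_zero)).add_const
    c).congr_deriv ?_
  rw [id]
  field_simp

theorem hasDerivAt_logSol (σ : ℝ) {t : ℝ} (ht : t ≠ 0) :
    HasDerivAt (logSol σ) (logSolEuler σ t / t) t := by
  refine (((hasDerivAt_log_half_add ht _).mul (hasDerivAt_regSol σ ht)).sub
    (hasDerivAt_comp_sq_scaled
      (isEntireCoeff_logCoeff.hasDerivAt_powerSum (σ * t ^ 2 / 4)))).congr_deriv ?_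
  rw [logSolEuler, ← isEntireCoeff_logCoeff.mul_powerSum_deriv]
  field_simp
  ring

theorem hasDerivAt_logSolEuler (σ : ℝ) {t : ℝ} (ht : t ≠ 0) :
    HasDerivAt (logSolEuler σ) (σ * t * logSol σ t) t := by
  refine (((hasDerivAt_regSol σ ht).add ((hasDerivAt_log_half_add ht _).mul
    (hasDerivAt_regSolEuler σ t))).sub ((hasDerivAt_comp_sq_scaled
      (hasDerivAt_powerSum_euler_logCoeff (σ * t ^ 2 / 4))).const_mul 2)).congr_deriv ?_
  rw [logSol, regSolEuler, ← isEntireCoeff_regCoeff.mul_powerSum_deriv]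
  field_simp
  ring

theorem regSol_mul_logSolEuler_sub (σ t : ℝ) :
    regSol σ t * logSolEuler σ t - regSolEuler σ t * logSol σ t = 1 := by
  rw [← powerSum_wronskian (σ * t ^ 2 / 4), logSolEuler, regSolEuler, logSol, regSol]
  ring

/-! ### Relation with the complex Bessel functions -/

theorem ofReal_powerSum_eq_tsum {a : ℕ → ℝ} {b : ℕ → ℂ} {w : ℂ} {y : ℝ}
    (hb : ∀ n, b n = (-1) ^ n * (a n : ℂ)) (hw : w = ((-y : ℝ) : ℂ)) :
    ∑' n, b n * w ^ n = (powerSum a y : ℂ) := by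
  rw [powerSum, Complex.ofReal_tsum]
  refine tsum_congr fun n => ?_
  rw [hb, hw]
  push_cast
  rw [mul_right_comm, ← mul_pow, neg_one_mul, neg_neg, mul_comm]

theorem besselJ0_eq_powerSum {z : ℂ} {y : ℝ} (h : z ^ 2 / 4 = ((-y : ℝ) : ℂ)) :
    besselJ0 z = (powerSum regCoeff y : ℂ) :=
  ofReal_powerSum_eq_tsum (fun n => by rw [regCoeff]; push_cast; ring) h

theorem besselY0_eq_powerSum {z : ℂ} {y : ℝ} (h : z ^ 2 / 4 = ((-y : ℝ) : ℂ)) :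
    besselY0 z = 2 / (π : ℂ) *
      ((Complex.log (z / 2) + (eulerMascheroniConstant : ℂ)) * (powerSum regCoeff y : ℂ)
        - (powerSum logCoeff y : ℂ)) := by
  rw [besselY0, besselJ0_eq_powerSum h, ofReal_powerSum_eq_tsum (a := logCoeff)
    (fun n => by rw [logCoeff]; push_cast; ring) h]
  ring

theorem besselJ0_ofReal (t : ℝ) : besselJ0 (t : ℂ) = (regSol (-1) t : ℂ) :=
  besselJ0_eq_powerSum (by push_cast; ring)

theorem besselY0_ofReal {t : ℝ} (ht : 0 < t) :
    besselY0 (t : ℂ) = ((2 / π * logSol (-1) t : ℝ) : ℂ) := by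
  have hlog : Complex.log ((t : ℂ) / 2) = ((log (t / 2) : ℝ) : ℂ) := by
    rw [Complex.ofReal_log (by positivity)]
    push_cast
    rfl
  rw [besselY0_eq_powerSum (y := -1 * t ^ 2 / 4) (by push_cast; ring), logSol, regSol, hlog]
  push_cast
  ring

theorem hankelH0_I_mul_ofReal {t : ℝ} (ht : 0 < t) :
    hankelH0 (Complex.I * (t : ℂ)) = Complex.I * ((2 / π * logSol 1 t : ℝ) : ℂ) := by
  have hsq : (Complex.I * (t : ℂ)) ^ 2 / 4 = ((-(1 * t ^ 2 / 4) : ℝ) : ℂ) := by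
    rw [mul_pow, Complex.I_sq]
    push_cast
    ring
  have hlog : Complex.log (Complex.I * (t : ℂ) / 2)
      = ((log (t / 2) : ℝ) : ℂ) + π / 2 * Complex.I := by
    rw [show Complex.I * (t : ℂ) / 2 = ((t / 2 : ℝ) : ℂ) * Complex.I by push_cast; ring,
      Complex.log_ofReal_mul (by positivity) Complex.I_ne_zero, Complex.log_I]
  have hπ : (π : ℂ) ≠ 0 := Complex.ofReal_ne_zero.2 pi_ne_zero
  rw [hankelH0, besselJ0_eq_powerSum hsq, besselY0_eq_powerSum hsq, hlog, logSol, regSol]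
  push_cast
  field_simp
  linear_combination (π : ℂ) * powerSum regCoeff (t ^ 2 / 4) * Complex.I_sq

/-- `Y₀(t) + (2/π) K₀(t)`, the real factor of `k² A` in the phase retrieval system. -/
def besselYK (t : ℝ) : ℝ := 2 / π * (logSol (-1) t - logSol 1 t)

theorem coeffA_eq {k : ℝ} {z x : Plane} (h : 0 < k * dist x z) :
    coeffA k z x = 1 / k ^ 2 * besselYK (k * dist x z) := by
  rw [coeffA, besselY0_ofReal h, hankelH0_I_mul_ofReal h, ← mul_assoc, Complex.I_mul_I, besselYK,
    Complex.add_re, Complex.ofReal_re, neg_one_mul, Complex.neg_re, Complex.ofReal_re]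
  ring

theorem coeffB_eq (k : ℝ) (z x : Plane) :
    coeffB k z x = -(1 / k ^ 2 * regSol (-1) (k * dist x z)) := by
  rw [coeffB, besselJ0_ofReal, Complex.ofReal_re]
  ring

theorem fundSol_eq {k : ℝ} {z x : Plane} (h : 0 < k * dist x z) :
    fundSol k x z = -(1 / 8 : ℂ) * ((coeffA k z x : ℂ) + (coeffB k z x : ℂ) * Complex.I) := by
  rw [coeffA_eq h, coeffB_eq, fundSol, hankelH0_I_mul_ofReal h, hankelH0, besselJ0_ofReal,
    besselY0_ofReal h, besselYK]
  push_cast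
  linear_combination (1 / (8 * (k : ℂ) ^ 2)) * (2 / (π : ℂ) * (logSol (-1) (k * dist x z) : ℂ)
    - 2 / (π : ℂ) * (logSol 1 (k * dist x z) : ℂ)) * Complex.I_mul_I

/-! ### Decay of the Macdonald function -/

theorem harmonic_lt_add_log (n : ℕ) :
    (harmonic n : ℝ) < eulerMascheroniConstant + log (n + 1) := by
  have h := eulerMascheroniSeq_lt_eulerMascheroniConstant n
  rw [eulerMascheroniSeq] at h
  linarith

theorem add_log_sub_lt_harmonic (n : ℕ) :
    eulerMascheroniConstant + log (n + 1) - 1 / ((n : ℝ) + 1) < harmonic n := by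
  have h := eulerMascheroniConstant_lt_eulerMascheroniSeq' (n + 1)
  rw [eulerMascheroniSeq', if_neg (Nat.succ_ne_zero n), harmonic_succ_cast] at h
  push_cast at h
  linarith

theorem harmonic_sub_le {r : ℝ} (hr : 0 < r) (n : ℕ) :
    harmonic n - eulerMascheroniConstant - log r ≤ 1 / 2 * ((n : ℝ) ^ 2 / r ^ 2 - 1) + 1 / r := by
  have hlog : log ((n : ℝ) + 1) - log r = log (((n : ℝ) + 1) / r) :=
    (Real.log_div (by positivity) hr.ne').symm
  calc harmonic n - eulerMascheroniConstant - log r ≤ log (((n : ℝ) + 1) / r) := by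
        linarith [harmonic_lt_add_log n]
    _ ≤ ((n : ℝ) + 1) / r - 1 := Real.log_le_sub_one_of_pos (by positivity)
    _ ≤ ((n : ℝ) + 1) / r - 1 + 1 / 2 * ((n : ℝ) / r - 1) ^ 2 :=
        le_add_of_nonneg_right (by positivity)
    _ = 1 / 2 * ((n : ℝ) ^ 2 / r ^ 2 - 1) + 1 / r := by ring

theorem le_harmonic_sub {r : ℝ} (hr : 0 < r) (n : ℕ) :
    1 - (r + 1) / (2 * r) * (r ^ 2 / ((n : ℝ) + 1) ^ 2 + 1)
      ≤ harmonic n - eulerMascheroniConstant - log r := by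
  have hlog : log ((n : ℝ) + 1) - log r = log (((n : ℝ) + 1) / r) :=
    (Real.log_div (by positivity) hr.ne').symm
  calc 1 - (r + 1) / (2 * r) * (r ^ 2 / ((n : ℝ) + 1) ^ 2 + 1)
      ≤ 1 - (r + 1) / (2 * r) * (r ^ 2 / ((n : ℝ) + 1) ^ 2 + 1)
          + (r + 1) / (2 * r) * (r / ((n : ℝ) + 1) - 1) ^ 2 :=
        le_add_of_nonneg_right (by positivity)
    _ = 1 - (((n : ℝ) + 1) / r)⁻¹ - 1 / ((n : ℝ) + 1) := by
        field_simp
        ring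
    _ ≤ log (((n : ℝ) + 1) / r) - 1 / ((n : ℝ) + 1) :=
        sub_le_sub_right (Real.one_sub_inv_le_log_of_pos (by positivity)) _
    _ ≤ harmonic n - eulerMascheroniConstant - log r := by
        linarith [add_log_sub_lt_harmonic n]

theorem regCoeff_mul_pow_nonneg {y : ℝ} (hy : 0 ≤ y) (n : ℕ) : 0 ≤ regCoeff n * y ^ n :=
  mul_nonneg (regCoeff_pos n).le (pow_nonneg hy n)

theorem hasSum_sq_mul_regCoeff (y : ℝ) :
    HasSum (fun n : ℕ => (n : ℝ) ^ 2 * (regCoeff n * y ^ n)) (y * powerSum regCoeff y) := by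
  have h := isEntireCoeff_regCoeff.euler.euler.hasSum y
  rw [← isEntireCoeff_regCoeff.euler.mul_powerSum_deriv, derivCoeff_eulerCoeff_regCoeff] at h
  exact h.congr_fun fun n => by
    rw [eulerCoeff, eulerCoeff]
    ring

theorem hasSum_div_sq_mul_regCoeff (y : ℝ) :
    HasSum (fun n : ℕ => y / ((n : ℝ) + 1) ^ 2 * (regCoeff n * y ^ n))
      (powerSum regCoeff y - 1) := by
  have h := (hasSum_nat_add_iff' 1).2 (isEntireCoeff_regCoeff.hasSum y)
  rw [Finset.sum_range_one, pow_zero, mul_one, show regCoeff 0 = 1 by simp [regCoeff]] at h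
  refine h.congr_fun fun n => ?_
  rw [← sq_mul_regCoeff_succ n]
  field_simp
  ring

theorem hasSum_harmonic_sub_mul_regCoeff (r : ℝ) :
    HasSum (fun n : ℕ => ((harmonic n : ℝ) - eulerMascheroniConstant - log r) *
      (regCoeff n * (r ^ 2) ^ n)) (-logSol 1 (2 * r)) := by
  have h := (isEntireCoeff_logCoeff.hasSum (r ^ 2)).sub
    ((isEntireCoeff_regCoeff.hasSum (r ^ 2)).mul_left (log r + eulerMascheroniConstant))
  rw [logSol, regSol, show 1 * (2 * r) ^ 2 / 4 = r ^ 2 by ring, mul_div_cancel_left₀ r two_ne_zero,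
    neg_sub]
  exact h.congr_fun fun n => by
    rw [logCoeff_eq_harmonic_mul]
    ring

-- `K₀(2r)` is the sum of `(hₙ - γ - log r) r²ⁿ / (n!)²`, and the weights `r²ⁿ / (n!)²` concentrate
-- at `n ≈ r`, where the first factor is small.
theorem abs_logSol_one_le {t : ℝ} (ht : 0 < t) : |logSol 1 t| ≤ 2 / t * regSol 1 t := by
  obtain ⟨r, rfl⟩ : ∃ r, t = 2 * r := ⟨t / 2, by ring⟩
  have hr : 0 < r := by linarith
  have hreg : regSol 1 (2 * r) = powerSum regCoeff (r ^ 2) := by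
    rw [regSol]
    congr 1
    ring
  have hsum := isEntireCoeff_regCoeff.hasSum (r ^ 2)
  have hlog := hasSum_harmonic_sub_mul_regCoeff r
  have hupper := hasSum_le (fun n => mul_le_mul_of_nonneg_right (harmonic_sub_le hr n)
    (regCoeff_mul_pow_nonneg (sq_nonneg r) n)) hlog
    ((((hasSum_sq_mul_regCoeff (r ^ 2)).mul_left (1 / (2 * r ^ 2))).add
      (hsum.mul_left (1 / r - 1 / 2))).congr_fun fun n => by ring)
  have hlower := hasSum_le (fun n => mul_le_mul_of_nonneg_right (le_harmonic_sub hr n)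
    (regCoeff_mul_pow_nonneg (sq_nonneg r) n))
    ((hsum.sub (((hasSum_div_sq_mul_regCoeff (r ^ 2)).add hsum).mul_left
      ((r + 1) / (2 * r)))).congr_fun fun n => by ring) hlog
  rw [hreg, abs_le]
  constructor
  · calc -(2 / (2 * r) * powerSum regCoeff (r ^ 2))
        = -(1 / (2 * r ^ 2) * (r ^ 2 * powerSum regCoeff (r ^ 2))
          + (1 / r - 1 / 2) * powerSum regCoeff (r ^ 2)) := by
          field_simp
          ring
      _ ≤ logSol 1 (2 * r) := by linarith
  · have : 0 ≤ (r + 1) / (2 * r) := by positivity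
    calc logSol 1 (2 * r) ≤ -(powerSum regCoeff (r ^ 2) - (r + 1) / (2 * r) *
          (powerSum regCoeff (r ^ 2) - 1 + powerSum regCoeff (r ^ 2))) := by linarith
      _ = 2 / (2 * r) * powerSum regCoeff (r ^ 2) - (r + 1) / (2 * r) := by
          field_simp
          ring
      _ ≤ 2 / (2 * r) * powerSum regCoeff (r ^ 2) := by linarith

theorem cubic_le_powerSum_regCoeff {y : ℝ} (hy : 0 ≤ y) :
    1 + y + y ^ 2 / 4 + y ^ 3 / 36 ≤ powerSum regCoeff y := by
  have h := (isEntireCoeff_regCoeff y).sum_le_tsum (Finset.range 4) fun n _ =>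
    regCoeff_mul_pow_nonneg hy n
  rw [powerSum]
  refine le_trans (le_of_eq ?_) h
  norm_num [Finset.sum_range_succ, regCoeff, Nat.factorial]
  ring

theorem cubic_le_regSol_one (t : ℝ) :
    1 + t ^ 2 / 4 + t ^ 4 / 64 + t ^ 6 / 2304 ≤ regSol 1 t := by
  refine le_trans (le_of_eq ?_) (cubic_le_powerSum_regCoeff (by positivity : 0 ≤ 1 * t ^ 2 / 4))
  ring

theorem regSol_one_pos (t : ℝ) : 0 < regSol 1 t :=
  lt_of_lt_of_le (by positivity) (cubic_le_regSol_one t)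

theorem powerSum_regCoeff_sub_one_le {y : ℝ} (hy : 0 ≤ y) :
    powerSum regCoeff y - 1 ≤ powerSum (eulerCoeff regCoeff) y := by
  have hle (n : ℕ) : (if n = 0 then -1 else 0) + regCoeff n * y ^ n
      ≤ eulerCoeff regCoeff n * y ^ n := by
    rcases n with _ | n
    · simp [regCoeff, eulerCoeff]
    · rw [if_neg n.succ_ne_zero, zero_add, eulerCoeff, mul_assoc]
      exact le_mul_of_one_le_left (regCoeff_mul_pow_nonneg hy _) (by simp)
  have hsum := hasSum_le hle ((hasSum_ite_eq 0 (-1)).add (isEntireCoeff_regCoeff.hasSum y))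
    (isEntireCoeff_regCoeff.euler.hasSum y)
  linarith

theorem regSol_one_le_regSolEuler {t : ℝ} (ht : 2 ≤ t) : regSol 1 t ≤ regSolEuler 1 t := by
  have hsub := powerSum_regCoeff_sub_one_le (by positivity : 0 ≤ 1 * t ^ 2 / 4)
  have hreg : 2 ≤ regSol 1 t := by
    have : 0 ≤ t ^ 4 / 64 + t ^ 6 / 2304 := by positivity
    nlinarith [cubic_le_regSol_one t]
  rw [regSol] at hreg ⊢
  rw [regSolEuler]
  linarith

theorem hasDerivAt_logSol_div_regSol {t : ℝ} (ht : 0 < t) :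
    HasDerivAt (fun t => logSol 1 t / regSol 1 t) (1 / (t * regSol 1 t ^ 2)) t := by
  have hreg := (regSol_one_pos t).ne'
  refine ((hasDerivAt_logSol 1 ht.ne').div (hasDerivAt_regSol 1 ht.ne') hreg).congr_deriv ?_
  field_simp
  linarith [regSol_mul_logSolEuler_sub 1 t]

theorem tendsto_logSol_div_regSol :
    Filter.Tendsto (fun t => logSol 1 t / regSol 1 t) Filter.atTop (nhds 0) := by
  refine squeeze_zero_norm' ?_ (tendsto_const_nhds.div_atTop Filter.tendsto_id :
    Filter.Tendsto (fun t : ℝ => 2 / t) Filter.atTop (nhds 0))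
  filter_upwards [Filter.eventually_gt_atTop 0] with t ht
  rw [Real.norm_eq_abs, abs_div, abs_of_pos (regSol_one_pos t), div_le_iff₀ (regSol_one_pos t)]
  exact abs_logSol_one_le ht

theorem tendsto_inv_regSol_sq :
    Filter.Tendsto (fun t => (regSol 1 t ^ 2)⁻¹) Filter.atTop (nhds 0) := by
  refine Filter.Tendsto.inv_tendsto_atTop (Filter.tendsto_atTop_mono (fun t => ?_)
    Filter.tendsto_id)
  have hreg : 1 + t ^ 2 / 4 ≤ regSol 1 t := by
    have : 0 ≤ t ^ 4 / 64 + t ^ 6 / 2304 := by positivity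
    linarith [cubic_le_regSol_one t]
  calc t ≤ 1 + t ^ 2 / 4 := by nlinarith [sq_nonneg (t - 2)]
    _ ≤ regSol 1 t := hreg
    _ ≤ regSol 1 t ^ 2 := le_self_pow₀ (by nlinarith [sq_nonneg t]) two_ne_zero

theorem le_of_tendsto_of_hasDerivAt_nonneg {f f' : ℝ → ℝ} {t₀ t L : ℝ}
    (hf : ∀ s, t₀ ≤ s → HasDerivAt f (f' s) s) (hf' : ∀ s, t₀ ≤ s → 0 ≤ f' s)
    (hlim : Filter.Tendsto f Filter.atTop (nhds L)) (ht : t₀ ≤ t) : f t ≤ L := by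
  have hmono : MonotoneOn f (Ici t₀) := by
    refine monotoneOn_of_hasDerivWithinAt_nonneg (f' := f') (convex_Ici t₀)
      (fun s hs => (hf s hs).continuousAt.continuousWithinAt) (fun s hs => ?_) fun s hs => ?_
    · exact (hf s (interior_subset hs)).hasDerivWithinAt
    · exact hf' s (interior_subset hs)
  refine ge_of_tendsto hlim ?_
  filter_upwards [Filter.eventually_ge_atTop t] with s hs
  exact hmono ht (ht.trans hs) hs

theorem logSol_one_nonpos {t : ℝ} (ht : 0 < t) : logSol 1 t ≤ 0 := by
  have hle : logSol 1 t / regSol 1 t ≤ 0 := by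
    refine le_of_tendsto_of_hasDerivAt_nonneg (f := fun t => logSol 1 t / regSol 1 t)
      (fun s hs => hasDerivAt_logSol_div_regSol (ht.trans_le hs)) (fun s hs => ?_)
      tendsto_logSol_div_regSol le_rfl
    have := ht.trans_le hs
    positivity
  simpa using (div_le_iff₀ (regSol_one_pos t)).1 hle

-- `K₀ / I₀` and `1 / (2 I₀²)` both tend to `0` at infinity, and the former decreases more slowly as
-- soon as `I₀ ≤ t I₀'`.
theorem neg_logSol_one_le {t : ℝ} (ht : 2 ≤ t) : -logSol 1 t ≤ 1 / (2 * regSol 1 t) := by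
  have hderiv (s : ℝ) (hs : 2 ≤ s) : HasDerivAt
      (fun t => -(logSol 1 t / regSol 1 t + 1 / 2 * (regSol 1 t ^ 2)⁻¹))
      ((regSolEuler 1 s - regSol 1 s) / (s * regSol 1 s ^ 3)) s := by
    have hreg := (regSol_one_pos s).ne'
    have hs0 : 0 < s := by linarith
    refine ((hasDerivAt_logSol_div_regSol hs0).add ((((hasDerivAt_regSol 1 hs0.ne').pow 2).inv
      (pow_ne_zero 2 hreg)).const_mul (1 / 2))).neg.congr_deriv ?_
    rw [Pi.pow_apply]
    push_cast
    field_simp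
    ring
  have hle := le_of_tendsto_of_hasDerivAt_nonneg hderiv (fun s hs => by
      have := regSol_one_pos s
      exact div_nonneg (sub_nonneg.2 (regSol_one_le_regSolEuler hs)) (by positivity))
    (tendsto_logSol_div_regSol.add (tendsto_inv_regSol_sq.const_mul (1 / 2))).neg ht
  have hreg := regSol_one_pos t
  have heq : -logSol 1 t = 1 / (2 * regSol 1 t)
      + -(logSol 1 t / regSol 1 t + 1 / 2 * (regSol 1 t ^ 2)⁻¹) * regSol 1 t := by
    field_simp
    ring
  rw [mul_zero, add_zero, neg_zero] at hle
  linarith [mul_nonpos_of_nonpos_of_nonneg hle hreg.le]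

theorem mul_le_regSol_one {t : ℝ} (ht : 7.85 ≤ t) : 16 * t ≤ regSol 1 t := by
  have hcube : (400 : ℝ) ≤ t ^ 3 := le_trans (by norm_num) (pow_le_pow_left₀ (by norm_num) ht 3)
  have : 400 * t ≤ t ^ 3 * t := mul_le_mul_of_nonneg_right hcube (by linarith)
  have : 160000 ≤ t ^ 3 * t ^ 3 := by nlinarith
  have : 61 ≤ t ^ 2 := by nlinarith
  nlinarith [cubic_le_regSol_one t]

theorem two_div_pi_mem : 2 / π ∈ Icc 0.6366 0.637 := by
  constructor
  · rw [le_div_iff₀ pi_pos]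
    linarith [pi_lt_d4]
  · rw [div_le_iff₀ pi_pos]
    linarith [pi_gt_d4]

theorem abs_sqrt_mul_logSol_one_le {t : ℝ} (ht : 7.85 ≤ t) :
    |√t * (2 / π * logSol 1 t)| ≤ 1 / 50 := by
  have ht0 : 0 < t := by linarith
  have hneg := neg_nonneg.2 (logSol_one_nonpos ht0)
  have hlog : -logSol 1 t ≤ 1 / (32 * t) :=
    (neg_logSol_one_le (by linarith)).trans
      (one_div_le_one_div_of_le (by positivity) (by linarith [mul_le_regSol_one ht]))
  have hsqrt : √t ≤ t := Real.sqrt_le_iff.2 ⟨ht0.le, by nlinarith⟩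
  have hπ : 2 / π ≤ 0.64 := two_div_pi_mem.2.trans (by norm_num)
  calc |√t * (2 / π * logSol 1 t)| = √t * (2 / π * -logSol 1 t) := by
        rw [abs_mul, abs_mul, abs_of_nonneg (Real.sqrt_nonneg t), abs_of_pos (by positivity),
          abs_of_nonpos (neg_nonneg.1 hneg)]
    _ ≤ t * (0.64 * (1 / (32 * t))) := by gcongr
    _ = 1 / 50 := by
        field_simp
        norm_num

/-! ### The Liouville normal form of Bessel's equation -/

/-- `w` solves `w'' + (1 + 1 / (4 t²)) w = 0` on the positive half-line, with derivative `w'`. These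
are the functions `√t u(t)`, where `u` solves Bessel's equation of order zero. -/
structure IsLiouvilleSol (w w' : ℝ → ℝ) : Prop where
  hasDerivAt : ∀ t, 0 < t → HasDerivAt w (w' t) t
  hasDerivAt_deriv : ∀ t, 0 < t → HasDerivAt w' (-(1 + 1 / (4 * t ^ 2)) * w t) t

theorem IsLiouvilleSol.sqrt_mul {u v : ℝ → ℝ} (hu : ∀ t, 0 < t → HasDerivAt u (v t / t) t)
    (hv : ∀ t, 0 < t → HasDerivAt v (-1 * t * u t) t) :
    IsLiouvilleSol (fun t => √t * u t) (fun t => (u t / 2 + v t) / √t) := by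
  refine ⟨fun t ht => ?_, fun t ht => ?_⟩ <;> have hsqrt := Real.sqrt_pos.2 ht
  · refine ((Real.hasDerivAt_sqrt ht.ne').mul (hu t ht)).congr_deriv ?_
    have hsq : √t ^ 2 = t := Real.sq_sqrt ht.le
    field_simp
    linear_combination (2 * v t) * hsq
  · refine ((((hu t ht).div_const 2).add (hv t ht)).div (Real.hasDerivAt_sqrt ht.ne')
      hsqrt.ne').congr_deriv ?_
    rw [Pi.add_apply]
    have hsq : √t ^ 2 = t := Real.sq_sqrt ht.le
    generalize √t = s at *
    subst hsq
    field_simp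
    ring

theorem IsLiouvilleSol.linearCombination {v v' w w' : ℝ → ℝ} (hv : IsLiouvilleSol v v')
    (hw : IsLiouvilleSol w w') (α β : ℝ) :
    IsLiouvilleSol (fun t => α * v t + β * w t) (fun t => α * v' t + β * w' t) where
  hasDerivAt t ht := ((hv.hasDerivAt t ht).const_mul α).add ((hw.hasDerivAt t ht).const_mul β)
  hasDerivAt_deriv t ht :=
    (((hv.hasDerivAt_deriv t ht).const_mul α).add
      ((hw.hasDerivAt_deriv t ht).const_mul β)).congr_deriv (by ring)

theorem IsLiouvilleSol.energy_mul_exp_antitoneOn {w w' : ℝ → ℝ} (h : IsLiouvilleSol w w') :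
    AntitoneOn (fun t => (w t ^ 2 + w' t ^ 2) * exp (1 / 4 * t⁻¹)) (Ioi 0) := by
  have hderiv (t : ℝ) (ht : 0 < t) :
      HasDerivAt (fun t => (w t ^ 2 + w' t ^ 2) * exp (1 / 4 * t⁻¹))
        (-(1 / (4 * t ^ 2) * (w t + w' t) ^ 2 * exp (1 / 4 * t⁻¹))) t := by
    refine ((((h.hasDerivAt t ht).pow 2).add ((h.hasDerivAt_deriv t ht).pow 2)).mul
      (((hasDerivAt_inv ht.ne').const_mul (1 / 4)).exp)).congr_deriv ?_
    simp only [Pi.add_apply, Pi.pow_apply]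
    push_cast
    field_simp
    ring
  refine antitoneOn_of_hasDerivWithinAt_nonpos (f' := fun t =>
    -(1 / (4 * t ^ 2) * (w t + w' t) ^ 2 * exp (1 / 4 * t⁻¹))) (convex_Ioi 0)
    (fun t ht => (hderiv t ht).continuousAt.continuousWithinAt)
    (fun t ht => (hderiv t (interior_subset ht)).hasDerivWithinAt) fun t _ => ?_
  exact neg_nonpos.2 (by positivity)

-- Variation of constants relative to the equation `w'' + w = 0`.
theorem IsLiouvilleSol.abs_sub_mul_sin_le {w w' : ℝ → ℝ} (h : IsLiouvilleSol w w') {s t B : ℝ}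
    (hs : 0 < s) (hst : s ≤ t) (hw : w s = 0) (hB : ∀ r ∈ Icc s t, |w r| ≤ B) :
    |w t - w' s * sin (t - s)| ≤ B / (4 * s ^ 2) * (t - s) := by
  have hderiv (r : ℝ) (hr : r ∈ Icc s t) :
      HasDerivWithinAt (fun r => w' r * sin (t - r) + w r * cos (t - r))
        (-(1 / (4 * r ^ 2)) * w r * sin (t - r)) (Icc s t) r := by
    have hr0 : 0 < r := hs.trans_le hr.1
    have hsub : HasDerivAt (fun r => t - r) (-1) r := (hasDerivAt_id r).const_sub t
    exact (((h.hasDerivAt_deriv r hr0).mul hsub.sin).add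
      ((h.hasDerivAt r hr0).mul hsub.cos)).congr_deriv (by ring) |>.hasDerivWithinAt
  have hbound (r : ℝ) (hr : r ∈ Icc s t) :
      ‖-(1 / (4 * r ^ 2)) * w r * sin (t - r)‖ ≤ B / (4 * s ^ 2) := by
    have hr0 : 0 < r := hs.trans_le hr.1
    have hB0 : 0 ≤ B := (abs_nonneg _).trans (hB r hr)
    rw [Real.norm_eq_abs, abs_mul, abs_mul, abs_neg, abs_of_pos (by positivity)]
    calc 1 / (4 * r ^ 2) * |w r| * |sin (t - r)| ≤ 1 / (4 * s ^ 2) * B * 1 := by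
          gcongr
          · exact hr.1
          · exact hB r hr
          · exact abs_sin_le_one _
      _ = B / (4 * s ^ 2) := by ring
  have hmean := (convex_Icc s t).norm_image_sub_le_of_norm_hasDerivWithin_le hderiv hbound
    (left_mem_Icc.2 hst) (right_mem_Icc.2 hst)
  simpa only [sub_self, sin_zero, cos_zero, mul_zero, mul_one, zero_add, hw, zero_mul, add_zero,
    Real.norm_eq_abs, abs_of_nonneg (sub_nonneg.2 hst)] using hmean

/-- The solution `√t J₀(t)` of the Liouville normal form. -/
def amplJ (t : ℝ) : ℝ := √t * regSol (-1) t

/-- The derivative of `amplJ`. -/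
def amplJDeriv (t : ℝ) : ℝ := (regSol (-1) t / 2 + regSolEuler (-1) t) / √t

/-- The solution `√t Y₀(t)` of the Liouville normal form. -/
def amplY (t : ℝ) : ℝ := √t * (2 / π * logSol (-1) t)

/-- The derivative of `amplY`. -/
def amplYDeriv (t : ℝ) : ℝ :=
  (2 / π * logSol (-1) t / 2 + 2 / π * logSolEuler (-1) t) / √t

theorem isLiouvilleSol_amplJ : IsLiouvilleSol amplJ amplJDeriv :=
  .sqrt_mul (fun _ ht => hasDerivAt_regSol (-1) ht.ne') fun t _ => hasDerivAt_regSolEuler (-1) t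

theorem isLiouvilleSol_amplY : IsLiouvilleSol amplY amplYDeriv :=
  .sqrt_mul (u := fun t => 2 / π * logSol (-1) t) (v := fun t => 2 / π * logSolEuler (-1) t)
    (fun _ ht => ((hasDerivAt_logSol (-1) ht.ne').const_mul (2 / π)).congr_deriv (by ring))
    fun _ ht => ((hasDerivAt_logSolEuler (-1) ht.ne').const_mul (2 / π)).congr_deriv (by ring)

theorem amplJ_mul_amplYDeriv_sub {t : ℝ} (ht : 0 < t) :
    amplJ t * amplYDeriv t - amplJDeriv t * amplY t = 2 / π := by
  have := Real.sqrt_pos.2 ht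
  rw [amplJ, amplJDeriv, amplY, amplYDeriv]
  field_simp
  linear_combination 2 * regSol_mul_logSolEuler_sub (-1) t

theorem regSol_neg_one_one_mem : regSol (-1) 1 ∈ Icc 0.765 0.7653 := by
  have h := abs_powerSum_regCoeff_sub_le (y := -1 * 1 ^ 2 / 4) (by norm_num [abs_le])
  rw [← regSol, abs_le] at h
  constructor <;> linarith

theorem regSolEuler_neg_one_one_mem : regSolEuler (-1) 1 ∈ Icc (-0.4404) (-0.4398) := by
  have h := abs_powerSum_euler_regCoeff_sub_le (y := -1 * 1 ^ 2 / 4) (by norm_num [abs_le])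
  rw [abs_le] at h
  rw [regSolEuler]
  constructor <;> linarith

theorem neg_log_half_add_eulerMascheroni_mem :
    -(log (1 / 2) + eulerMascheroniConstant) ∈ Icc 0.0264 0.1932 := by
  rw [one_div, Real.log_inv]
  constructor <;> linarith [Real.log_two_gt_d9, Real.log_two_lt_d9,
    Real.one_half_lt_eulerMascheroniConstant, Real.eulerMascheroniConstant_lt_two_thirds]

theorem logSol_neg_one_one_mem : logSol (-1) 1 ∈ Icc 0 0.21 := by
  have hseries := abs_powerSum_logCoeff_sub_le (y := -1 * 1 ^ 2 / 4) (by norm_num [abs_le])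
  obtain ⟨hreg₁, hreg₂⟩ := regSol_neg_one_one_mem
  obtain ⟨hlog₁, hlog₂⟩ := neg_log_half_add_eulerMascheroni_mem
  have hupper := mul_le_mul hlog₂ hreg₂ (by linarith) (by norm_num)
  have hlower := mul_le_mul hlog₁ hreg₁ (by norm_num) (by linarith)
  rw [abs_le] at hseries
  rw [logSol]
  constructor <;> linarith

theorem logSolEuler_neg_one_one_mem : logSolEuler (-1) 1 ∈ Icc 0 1.265 := by
  have hseries := abs_powerSum_euler_logCoeff_sub_le (y := -1 * 1 ^ 2 / 4) (by norm_num [abs_le])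
  obtain ⟨hreg₁, hreg₂⟩ := regSol_neg_one_one_mem
  obtain ⟨hreg₁', hreg₂'⟩ := regSolEuler_neg_one_one_mem
  obtain ⟨hlog₁, hlog₂⟩ := neg_log_half_add_eulerMascheroni_mem
  have hupper := mul_le_mul hlog₂ (neg_le_neg hreg₁') (by linarith) (by norm_num)
  have hlower := mul_nonneg (hlog₁.trans' (by norm_num)) (neg_nonneg.2 (hreg₂'.trans (by norm_num)))
  rw [abs_le] at hseries
  rw [logSolEuler]
  constructor <;> linarith

theorem energy_amplJ_one_le : amplJ 1 ^ 2 + amplJDeriv 1 ^ 2 ≤ 0.59 := by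
  obtain ⟨hreg₁, hreg₂⟩ := regSol_neg_one_one_mem
  obtain ⟨hreg₁', hreg₂'⟩ := regSolEuler_neg_one_one_mem
  have hval : |regSol (-1) 1| ≤ 0.7653 := abs_le.2 ⟨by linarith, hreg₂⟩
  have hderiv : |regSol (-1) 1 / 2 + regSolEuler (-1) 1| ≤ 0.06 :=
    abs_le.2 ⟨by linarith, by linarith⟩
  rw [amplJ, amplJDeriv, Real.sqrt_one, one_mul, div_one]
  linarith [sq_le_sq' (abs_le.1 hval).1 (abs_le.1 hval).2,
    sq_le_sq' (abs_le.1 hderiv).1 (abs_le.1 hderiv).2]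

theorem energy_amplY_one_le : amplY 1 ^ 2 + amplYDeriv 1 ^ 2 ≤ 0.78 := by
  obtain ⟨hlog₁, hlog₂⟩ := logSol_neg_one_one_mem
  obtain ⟨hlog₁', hlog₂'⟩ := logSolEuler_neg_one_one_mem
  have hπ : 2 / π ≤ 0.637 := two_div_pi_mem.2
  have hval : 2 / π * logSol (-1) 1 ≤ 0.637 * 0.21 := by gcongr
  have hderiv : 2 / π * logSolEuler (-1) 1 ≤ 0.637 * 1.265 := by gcongr
  rw [amplY, amplYDeriv, Real.sqrt_one, one_mul, div_one]
  calc (2 / π * logSol (-1) 1) ^ 2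
        + (2 / π * logSol (-1) 1 / 2 + 2 / π * logSolEuler (-1) 1) ^ 2
      ≤ (0.637 * 0.21) ^ 2 + (0.637 * 0.21 / 2 + 0.637 * 1.265) ^ 2 := by gcongr
    _ ≤ 0.78 := by norm_num

theorem exp_quarter_le : exp (1 / 4) ≤ 1.29 := by
  refine le_of_pow_le_pow_left₀ (n := 4) (by norm_num) (by norm_num) ?_
  rw [← Real.exp_nat_mul]
  norm_num
  linarith [Real.exp_one_lt_d9]

/-! ### Bessel functions of large argument -/

theorem IsLiouvilleSol.sq_le_of_one_le {w w' : ℝ → ℝ} (h : IsLiouvilleSol w w') {t : ℝ}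
    (ht : 1 ≤ t) : w t ^ 2 ≤ 1.29 * (w 1 ^ 2 + w' 1 ^ 2) := by
  have hanti := h.energy_mul_exp_antitoneOn (mem_Ioi.2 one_pos)
    (mem_Ioi.2 (one_pos.trans_le ht)) ht
  simp only [inv_one, mul_one] at hanti
  calc w t ^ 2 ≤ (w t ^ 2 + w' t ^ 2) * 1 := by linarith [sq_nonneg (w' t)]
    _ ≤ (w t ^ 2 + w' t ^ 2) * exp (1 / 4 * t⁻¹) := by
        gcongr
        exact Real.one_le_exp (by positivity)
    _ ≤ (w 1 ^ 2 + w' 1 ^ 2) * exp (1 / 4) := hanti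
    _ ≤ 1.29 * (w 1 ^ 2 + w' 1 ^ 2) := by
        rw [mul_comm]
        gcongr
        exact exp_quarter_le

theorem amplJ_sq_add_amplY_sq_le {t : ℝ} (ht : 1 ≤ t) : amplJ t ^ 2 + amplY t ^ 2 ≤ 1.78 := by
  linarith [isLiouvilleSol_amplJ.sq_le_of_one_le ht, isLiouvilleSol_amplY.sq_le_of_one_le ht,
    energy_amplJ_one_le, energy_amplY_one_le]

theorem abs_amplJ_le {t : ℝ} (ht : 1 ≤ t) : |amplJ t| ≤ 1.335 :=
  abs_le_of_sq_le_sq (by linarith [amplJ_sq_add_amplY_sq_le ht, sq_nonneg (amplY t)])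
    (by norm_num)

theorem abs_amplY_le {t : ℝ} (ht : 1 ≤ t) : |amplY t| ≤ 1.335 :=
  abs_le_of_sq_le_sq (by linarith [amplJ_sq_add_amplY_sq_le ht, sq_nonneg (amplJ t)])
    (by norm_num)

theorem abs_cross_ampl_sub_sin_le {s t : ℝ} (hs : 1 ≤ s) (hst : s ≤ t) :
    |amplJ s * amplY t - amplJ t * amplY s - 2 / π * sin (t - s)|
      ≤ 1.78 / (4 * s ^ 2) * (t - s) := by
  have hcross := isLiouvilleSol_amplY.linearCombination isLiouvilleSol_amplJ (amplJ s) (-amplY s)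
  have hbound (r : ℝ) (hr : r ∈ Icc s t) : |amplJ s * amplY r + -amplY s * amplJ r| ≤ 1.78 := by
    have hs_sq := amplJ_sq_add_amplY_sq_le hs
    have hr_sq := amplJ_sq_add_amplY_sq_le (hs.trans hr.1)
    rw [abs_le]
    constructor
    · nlinarith [sq_nonneg (amplJ s + amplY r), sq_nonneg (amplJ r - amplY s)]
    · nlinarith [sq_nonneg (amplJ s - amplY r), sq_nonneg (amplJ r + amplY s)]
  convert hcross.abs_sub_mul_sin_le (by linarith) hst (by ring) hbound using 3
  · ring
  · rw [← amplJ_mul_amplYDeriv_sub (one_pos.trans_le hs)]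
    ring

theorem cross_ampl_ge {s t : ℝ} (hs : 7.85 ≤ s) (h₁ : 1.15 ≤ t - s) (h₂ : t - s ≤ π / 2) :
    0.449 ≤ amplJ s * amplY t - amplJ t * amplY s := by
  have hclose := (abs_le.1 (abs_cross_ampl_sub_sin_le (by linarith) (by linarith : s ≤ t))).1
  have hπ : 0.6366 ≤ 2 / π := two_div_pi_mem.1
  have hsin : 0.6366 * 1.15 ≤ sin (t - s) :=
    (mul_le_mul hπ h₁ (by norm_num) (by positivity)).trans
      (Real.mul_le_sin (by linarith) h₂)
  have hmain : 0.6366 * (0.6366 * 1.15) ≤ 2 / π * sin (t - s) := by gcongr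
  have herror : 1.78 / (4 * s ^ 2) * (t - s) ≤ 1.78 / (4 * 7.85 ^ 2) * (3.1416 / 2) := by
    gcongr
    linarith [pi_lt_d4]
  norm_num at hmain herror ⊢
  linarith

theorem sqrt_mul_besselYK (t : ℝ) :
    √t * besselYK t = amplY t - √t * (2 / π * logSol 1 t) := by
  rw [besselYK, amplY]
  ring

theorem mul_besselYK_sq_add_le {t : ℝ} (ht : 7.85 ≤ t) :
    t * (besselYK t ^ 2 + regSol (-1) t ^ 2) ≤ 1.9 := by
  have hampl := amplJ_sq_add_amplY_sq_le (by linarith : 1 ≤ t)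
  have hY := abs_le.1 (abs_amplY_le (by linarith : 1 ≤ t))
  have hK := abs_le.1 (abs_sqrt_mul_logSol_one_le ht)
  calc t * (besselYK t ^ 2 + regSol (-1) t ^ 2) = (√t * besselYK t) ^ 2 + amplJ t ^ 2 := by
        rw [amplJ, mul_pow, mul_pow, Real.sq_sqrt (by linarith)]
        ring
    _ ≤ 1.9 := by
        rw [sqrt_mul_besselYK]
        nlinarith

theorem cross_besselYK_ge {s t : ℝ} (hs : 7.85 ≤ s) (h₁ : 1.15 ≤ t - s) (h₂ : t - s ≤ π / 2) :
    0.38 ≤ √s * √t * (regSol (-1) s * besselYK t - regSol (-1) t * besselYK s) := by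
  have hKt : |amplJ s * (√t * (2 / π * logSol 1 t))| ≤ 1.335 * (1 / 50) := by
    rw [abs_mul]
    exact mul_le_mul (abs_amplJ_le (by linarith)) (abs_sqrt_mul_logSol_one_le (by linarith))
      (abs_nonneg _) (by norm_num)
  have hKs : |amplJ t * (√s * (2 / π * logSol 1 s))| ≤ 1.335 * (1 / 50) := by
    rw [abs_mul]
    exact mul_le_mul (abs_amplJ_le (by linarith)) (abs_sqrt_mul_logSol_one_le hs)
      (abs_nonneg _) (by norm_num)
  calc 0.38 ≤ amplJ s * amplY t - amplJ t * amplY s - (amplJ s * (√t * (2 / π * logSol 1 t))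
        - amplJ t * (√s * (2 / π * logSol 1 s))) := by
        linarith [cross_ampl_ge hs h₁ h₂, (abs_le.1 hKt).2, (abs_le.1 hKs).1]
    _ = √s * √t * (regSol (-1) s * besselYK t - regSol (-1) t * besselYK s) := by
        simp only [amplJ]
        linear_combination -(√s * regSol (-1) s) * sqrt_mul_besselYK t
          + (√t * regSol (-1) t) * sqrt_mul_besselYK s

/-! ### Small arguments -/

theorem besselYK_eq (t : ℝ) : besselYK t = 2 / π *
    ((powerSum logCoeff (1 * t ^ 2 / 4) - powerSum logCoeff (-1 * t ^ 2 / 4)) -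
      (log (t / 2) + eulerMascheroniConstant) * (regSol 1 t - regSol (-1) t)) := by
  rw [besselYK, logSol, logSol]
  ring

section Series

variable {t : ℝ}

theorem abs_mul_sq_div_four_le_one {σ : ℝ} (hσ : |σ| = 1) (ht : t ^ 2 ≤ 4) :
    |σ * t ^ 2 / 4| ≤ 1 := by
  rw [abs_div, abs_mul, hσ, abs_sq, abs_of_pos (by norm_num : (0 : ℝ) < 4)]
  linarith

theorem abs_regSol_neg_one_sub_le (ht : t ^ 2 ≤ 4) :
    |regSol (-1) t - (1 - t ^ 2 / 4 + t ^ 4 / 64 - t ^ 6 / 2304)| ≤ t ^ 8 / 73728 := by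
  convert abs_powerSum_regCoeff_sub_le (abs_mul_sq_div_four_le_one (σ := -1) (by simp) ht) using 1
  · rw [regSol]
    congr 2
    ring
  · ring

theorem abs_regSol_one_sub_regSol_neg_one_sub_le (ht : t ^ 2 ≤ 4) :
    |regSol 1 t - regSol (-1) t - (t ^ 2 / 2 + t ^ 6 / 1152)| ≤ t ^ 8 / 36864 := by
  have hpos := abs_le.1
    (abs_powerSum_regCoeff_sub_le (abs_mul_sq_div_four_le_one (σ := 1) (by simp) ht))
  have hneg := abs_le.1
    (abs_powerSum_regCoeff_sub_le (abs_mul_sq_div_four_le_one (σ := -1) (by simp) ht))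
  rw [regSol, regSol, abs_le]
  constructor <;> linarith

theorem abs_powerSum_logCoeff_sub_powerSum_logCoeff_sub_le (ht : t ^ 2 ≤ 4) :
    |powerSum logCoeff (1 * t ^ 2 / 4) - powerSum logCoeff (-1 * t ^ 2 / 4) -
      (t ^ 2 / 2 + 11 / 6912 * t ^ 6)| ≤ t ^ 8 / 9216 := by
  have hpos := abs_le.1
    (abs_powerSum_logCoeff_sub_le (abs_mul_sq_div_four_le_one (σ := 1) (by simp) ht))
  have hneg := abs_le.1
    (abs_powerSum_logCoeff_sub_le (abs_mul_sq_div_four_le_one (σ := -1) (by simp) ht))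
  rw [abs_le]
  constructor <;> linarith

end Series

theorem pow_mem_of_sq_mem {t l h : ℝ} (hl : 0 ≤ l) (ht : t ^ 2 ∈ Icc l h) (n : ℕ) :
    t ^ (2 * n) ∈ Icc (l ^ n) (h ^ n) := by
  rw [pow_mul]
  exact ⟨pow_le_pow_left₀ hl ht.1 n, pow_le_pow_left₀ (sq_nonneg t) ht.2 n⟩

theorem neg_two_le_log_of_le {x : ℝ} (hx : 0.155 ≤ x) : -2 ≤ log x := by
  have hexp : (2.7 : ℝ) ^ 2 ≤ exp 2 := by
    rw [← Real.exp_one_rpow 2, Real.rpow_two]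
    gcongr
    linarith [exp_one_gt_d9]
  rw [Real.le_log_iff_exp_le (by linarith), exp_neg]
  exact (inv_anti₀ (by norm_num) hexp).trans (hx.trans' (by norm_num))

theorem neg_log_half_add_mem_of_mem_Icc {t : ℝ} (ht : t ∈ Icc 0.31 0.35) :
    -(log (t / 2) + eulerMascheroniConstant) ∈ Icc 0 1.5 := by
  obtain ⟨ht₁, ht₂⟩ := ht
  constructor <;> linarith [neg_two_le_log_of_le (by linarith : 0.155 ≤ t / 2),
    log_le_sub_one_of_pos (by linarith : 0 < t / 2),
    one_half_lt_eulerMascheroniConstant, eulerMascheroniConstant_lt_two_thirds]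

theorem log_half_add_mem_of_mem_Icc {t : ℝ} (ht : t ∈ Icc 1.5 1.6) :
    log (t / 2) + eulerMascheroniConstant ∈ Icc 0 (2 / 3) := by
  obtain ⟨ht₁, ht₂⟩ := ht
  have hinv : (t / 2)⁻¹ ≤ 1.34 :=
    (inv_anti₀ (by norm_num) (by linarith : 0.75 ≤ t / 2)).trans (by norm_num)
  constructor <;> linarith [one_sub_inv_le_log_of_pos (by linarith : 0 < t / 2),
    log_le_sub_one_of_pos (by linarith : 0 < t / 2),
    one_half_lt_eulerMascheroniConstant, eulerMascheroniConstant_lt_two_thirds]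

section SmallArguments

variable {t : ℝ}

theorem regSol_neg_one_mem_of_small (ht : t ^ 2 ∈ Icc 0.0986 0.1186) :
    regSol (-1) t ∈ Icc 0.96 1 := by
  have happrox := abs_le.1 (abs_regSol_neg_one_sub_le (ht.2.trans (by norm_num)))
  have h₂ := ht
  have h₄ := pow_mem_of_sq_mem (by norm_num) ht 2
  have h₆ := pow_mem_of_sq_mem (by norm_num) ht 3
  have h₈ := pow_mem_of_sq_mem (by norm_num) ht 4
  norm_num [mem_Icc] at h₂ h₄ h₆ h₈
  constructor <;> linarith

theorem besselYK_mem_of_small (h₀ : 0 < t) (ht : t ^ 2 ∈ Icc 0.0986 0.1186) :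
    besselYK t ∈ Icc 0 0.1 := by
  have hreg := abs_le.1
    (abs_regSol_one_sub_regSol_neg_one_sub_le (ht.2.trans (by norm_num)))
  have hlog := abs_le.1
    (abs_powerSum_logCoeff_sub_powerSum_logCoeff_sub_le (ht.2.trans (by norm_num)))
  obtain ⟨hlogt₀, hlogt₁⟩ := neg_log_half_add_mem_of_mem_Icc (t := t)
    ⟨by nlinarith [ht.1], by nlinarith [ht.2]⟩
  have h₂ := ht
  have h₆ := pow_mem_of_sq_mem (by norm_num) ht 3
  have h₈ := pow_mem_of_sq_mem (by norm_num) ht 4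
  norm_num [mem_Icc] at h₂ h₆ h₈
  have hπ₂ := two_div_pi_mem.2
  have hreg₀ : 0 ≤ regSol 1 t - regSol (-1) t := by linarith
  have hreg₁ : regSol 1 t - regSol (-1) t ≤ 0.0595 := by linarith
  have hprod₀ := mul_nonneg hlogt₀ hreg₀
  have hprod₁ := mul_le_mul hlogt₁ hreg₁ hreg₀ (by norm_num)
  rw [besselYK_eq]
  constructor
  · exact mul_nonneg (by positivity) (by linarith)
  · calc 2 / π * _ ≤ 0.637 * 0.14875 :=
          mul_le_mul hπ₂ (by linarith) (by linarith) (by norm_num)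
      _ ≤ 0.1 := by norm_num

theorem regSol_neg_one_mem_of_moderate (ht : t ^ 2 ∈ Icc 2.407 2.4685) :
    regSol (-1) t ∈ Icc 0 0.49 := by
  have happrox := abs_le.1 (abs_regSol_neg_one_sub_le (ht.2.trans (by norm_num)))
  have h₂ := ht
  have h₄ := pow_mem_of_sq_mem (by norm_num) ht 2
  have h₆ := pow_mem_of_sq_mem (by norm_num) ht 3
  have h₈ := pow_mem_of_sq_mem (by norm_num) ht 4
  norm_num [mem_Icc] at h₂ h₄ h₆ h₈
  constructor <;> linarith

theorem besselYK_mem_of_moderate (h₀ : 0 < t) (ht : t ^ 2 ∈ Icc 2.407 2.4685) :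
    besselYK t ∈ Icc 0.26 0.81 := by
  have hreg := abs_le.1
    (abs_regSol_one_sub_regSol_neg_one_sub_le (ht.2.trans (by norm_num)))
  have hlog := abs_le.1
    (abs_powerSum_logCoeff_sub_powerSum_logCoeff_sub_le (ht.2.trans (by norm_num)))
  obtain ⟨hlogt₀, hlogt₁⟩ := log_half_add_mem_of_mem_Icc (t := t)
    ⟨by nlinarith [ht.1], by nlinarith [ht.2]⟩
  have h₂ := ht
  have h₆ := pow_mem_of_sq_mem (by norm_num) ht 3
  have h₈ := pow_mem_of_sq_mem (by norm_num) ht 4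
  norm_num [mem_Icc] at h₂ h₆ h₈
  obtain ⟨hπ₁, hπ₂⟩ := two_div_pi_mem
  have hreg₀ : 0 ≤ regSol 1 t - regSol (-1) t := by linarith
  have hprod₀ := mul_nonneg hlogt₀ hreg₀
  have hprod₁ := mul_le_mul_of_nonneg_right hlogt₁ hreg₀
  rw [besselYK_eq]
  constructor
  · calc (0.26 : ℝ) ≤ 0.6366 * 0.409 := by norm_num
      _ ≤ 2 / π * _ := mul_le_mul hπ₁ (by linarith) (by norm_num) (by positivity)
  · calc 2 / π * _ ≤ 0.637 * 1.27 := mul_le_mul hπ₂ (by linarith) (by linarith) (by norm_num)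
      _ ≤ 0.81 := by norm_num

end SmallArguments

/-! ### The determinant of the system -/

theorem norm_fundSol_sq {k : ℝ} {z x : Plane} (h : 0 < k * dist x z) :
    ‖fundSol k x z‖ ^ 2 = (coeffA k z x ^ 2 + coeffB k z x ^ 2) / 64 := by
  rw [fundSol_eq h, norm_mul, mul_pow, ← Complex.normSq_eq_norm_sq
    ((coeffA k z x : ℂ) + (coeffB k z x : ℂ) * Complex.I), Complex.normSq_add_mul_I, norm_neg,
    norm_div, norm_one, RCLike.norm_ofNat]
  ring

theorem norm_fundSol_le {k β : ℝ} {z x : Plane} (h : 0 < k * dist x z) (hβ : 0 ≤ β)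
    (hbound : besselYK (k * dist x z) ^ 2 + regSol (-1) (k * dist x z) ^ 2 ≤ β ^ 2) :
    ‖fundSol k x z‖ ≤ β / (8 * k ^ 2) := by
  refine le_of_sq_le_sq ?_ (by positivity)
  calc ‖fundSol k x z‖ ^ 2
      = (besselYK (k * dist x z) ^ 2 + regSol (-1) (k * dist x z) ^ 2) / (8 * k ^ 2) ^ 2 := by
        rw [norm_fundSol_sq h, coeffA_eq h, coeffB_eq]
        ring
    _ ≤ β ^ 2 / (8 * k ^ 2) ^ 2 := by gcongr
    _ = (β / (8 * k ^ 2)) ^ 2 := (div_pow _ _ _).symm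

/-- The determinant of the phase retrieval system at the point `x`. -/
def systemDet (k : ℝ) (z : Fin 2 → Plane) (x : Plane) : ℝ :=
  coeffA k (z 0) x * coeffB k (z 1) x - coeffA k (z 1) x * coeffB k (z 0) x

theorem systemDet_eq {k : ℝ} {z : Fin 2 → Plane} {x : Plane} (h : ∀ l, 0 < k * dist x (z l)) :
    systemDet k z x = 1 / k ^ 4 *
      (regSol (-1) (k * dist x (z 0)) * besselYK (k * dist x (z 1)) -
        regSol (-1) (k * dist x (z 1)) * besselYK (k * dist x (z 0))) := by
  rw [systemDet, coeffA_eq (h 0), coeffA_eq (h 1), coeffB_eq, coeffB_eq]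
  ring

/-- Uniform solvability of the phase retrieval system on `Γ`: the determinant is at least `1 / κ`
times the product of upper bounds `b ℓ` for the point sources. -/
structure WellPosedOn (k κ : ℝ) (Γ : Set Plane) (z : Fin 2 → Plane) (b : Fin 2 → ℝ) : Prop where
  bound_pos : ∀ l, 0 < b l
  dist_pos : ∀ x ∈ Γ, ∀ l, 0 < k * dist x (z l)
  norm_fundSol_le : ∀ x ∈ Γ, ∀ l, ‖fundSol k x (z l)‖ ≤ b l
  mul_le_systemDet : ∀ x ∈ Γ, b 0 * b 1 ≤ κ * |systemDet k z x|

theorem wellPosedOn_of_besselYK_bounds {k κ : ℝ} {Γ : Set Plane} {z : Fin 2 → Plane}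
    {β : Fin 2 → ℝ} (hk : 0 < k) (hβ : ∀ l, 0 < β l) (hpos : ∀ x ∈ Γ, ∀ l, 0 < k * dist x (z l))
    (hnorm : ∀ x ∈ Γ, ∀ l,
      besselYK (k * dist x (z l)) ^ 2 + regSol (-1) (k * dist x (z l)) ^ 2 ≤ β l ^ 2)
    (hcross : ∀ x ∈ Γ, β 0 * β 1 ≤ 64 * κ *
      |regSol (-1) (k * dist x (z 0)) * besselYK (k * dist x (z 1)) -
        regSol (-1) (k * dist x (z 1)) * besselYK (k * dist x (z 0))|) :
    WellPosedOn k κ Γ z fun l => β l / (8 * k ^ 2) where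
  bound_pos l := div_pos (hβ l) (by positivity)
  dist_pos := hpos
  norm_fundSol_le x hx l := norm_fundSol_le (hpos x hx l) (hβ l).le (hnorm x hx l)
  mul_le_systemDet x hx := by
    rw [systemDet_eq (hpos x hx), abs_mul, abs_of_pos (by positivity)]
    calc β 0 / (8 * k ^ 2) * (β 1 / (8 * k ^ 2)) = β 0 * β 1 / (64 * k ^ 4) := by ring
      _ ≤ _ / (64 * k ^ 4) := div_le_div_of_nonneg_right (hcross x hx) (by positivity)
      _ = _ := by ring

namespace WellPosedOn

variable {k κ : ℝ} {Γ : Set Plane} {z : Fin 2 → Plane} {b : Fin 2 → ℝ}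

theorem systemDet_ne_zero (h : WellPosedOn k κ Γ z b) {x : Plane} (hx : x ∈ Γ) :
    systemDet k z x ≠ 0 := by
  intro hdet
  have hle := h.mul_le_systemDet x hx
  rw [hdet, abs_zero, mul_zero] at hle
  exact hle.not_gt (mul_pos (h.bound_pos 0) (h.bound_pos 1))

theorem fundSol_ne_zero (h : WellPosedOn k κ Γ z b) {x : Plane} (hx : x ∈ Γ) (l : Fin 2) :
    fundSol k x (z l) ≠ 0 := by
  intro hzero
  have hsq := norm_fundSol_sq (h.dist_pos x hx l)
  rw [hzero, norm_zero] at hsq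
  obtain ⟨hA, hB⟩ : coeffA k (z l) x = 0 ∧ coeffB k (z l) x = 0 := by
    constructor <;> nlinarith [sq_nonneg (coeffA k (z l) x), sq_nonneg (coeffB k (z l) x)]
  refine h.systemDet_ne_zero hx ?_
  rw [systemDet]
  obtain rfl | rfl : l = 0 ∨ l = 1 := by omega
  all_goals rw [hA, hB]; ring

end WellPosedOn

/-! ### Geometry of the arcs -/

theorem dist_polar_sq (R ρ θ φ : ℝ) :
    dist (polar R θ) (polar ρ φ) ^ 2 = (R - ρ) ^ 2 + 2 * R * ρ * (1 - cos (θ - φ)) := by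
  rw [EuclideanSpace.dist_eq, Real.sq_sqrt (Finset.sum_nonneg fun i _ => sq_nonneg _)]
  simp only [Fin.sum_univ_two, polar, Real.dist_eq, sq_abs, PiLp.toLp_apply,
    Matrix.cons_val_zero, Matrix.cons_val_one]
  rw [Real.cos_sub]
  linear_combination R ^ 2 * Real.sin_sq_add_cos_sq θ + ρ ^ 2 * Real.sin_sq_add_cos_sq φ

theorem one_sub_cos_mem_of_abs_le {θ : ℝ} {m : ℕ} (hm : 10 ≤ m) (hθ : |θ| ≤ π / m) :
    1 - cos θ ∈ Icc 0 0.05 := by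
  have hθ' : |θ| ≤ 0.31416 := calc
    |θ| ≤ π / m := hθ
    _ ≤ 3.1416 / 10 := by
      gcongr
      · exact pi_lt_d4.le
      · exact_mod_cast hm
    _ = 0.31416 := by norm_num
  have hsq : θ ^ 2 ≤ 0.31416 ^ 2 := sq_le_sq' (abs_le.1 hθ').1 (abs_le.1 hθ').2
  constructor <;> linarith [cos_le_one θ, one_sub_sq_div_two_le_cos (x := θ)]

theorem exists_dist_sq_eq_of_mem_arc {R : ℝ} {m j : ℕ} (hm : 10 ≤ m) {x : Plane}
    (hx : x ∈ arc R m j) : ∃ δ ∈ Icc (0 : ℝ) 0.05, ∀ ρ,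
      dist x (polar ρ (gridAngle m (2 * j - 1))) ^ 2 = (R - ρ) ^ 2 + 2 * R * ρ * δ := by
  obtain ⟨θ, ⟨hθ₁, hθ₂⟩, rfl⟩ := hx
  refine ⟨_, one_sub_cos_mem_of_abs_le hm ?_, fun ρ => dist_polar_sq R ρ θ _⟩
  have hprev : gridAngle m (2 * j - 2) = gridAngle m (2 * j - 1) - π / m := by
    simp only [gridAngle]
    push_cast
    ring
  have hnext : gridAngle m (2 * j) = gridAngle m (2 * j - 1) + π / m := by
    simp only [gridAngle]
    push_cast
    ring
  rw [abs_le]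
  constructor <;> linarith

theorem exists_mul_dist_sourcePoint_sq_eq {a τ : ℝ} (k : ℝ) {m j : ℕ} (hm : 10 ≤ m) {x : Plane}
    (hx : x ∈ arc (radius a τ k) m j) : ∃ δ ∈ Icc (0 : ℝ) 0.05, ∀ l,
      (k * dist x (sourcePoint a τ k m j l)) ^ 2 =
        ((1 - ratio a τ k l) * (k * radius a τ k)) ^ 2 +
          2 * ratio a τ k l * (k * radius a τ k) ^ 2 * δ := by
  obtain ⟨δ, hδ, hdist⟩ := exists_dist_sq_eq_of_mem_arc hm hx
  refine ⟨δ, hδ, fun l => ?_⟩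
  rw [mul_pow, sourcePoint, hdist]
  ring

section LargeRadius

variable {X δ s t : ℝ}

theorem inner_dist_mem (hδ : δ ∈ Icc 0 0.05) (hX : 0 ≤ X) (hs : 0 ≤ s)
    (hs_sq : s ^ 2 = (X / 2) ^ 2 + X ^ 2 * δ) : s ∈ Icc (X / 2) (1.05 ^ 2 * (X / 2)) := by
  have hδ₀ : 0 ≤ X ^ 2 * δ := mul_nonneg (sq_nonneg X) hδ.1
  have hδ₁ : X ^ 2 * δ ≤ X ^ 2 * 0.05 := by gcongr; exact hδ.2
  exact ⟨le_of_sq_le_sq (by linarith) hs, le_of_sq_le_sq (by nlinarith) (by positivity)⟩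

theorem outer_dist_mem (hδ : δ ∈ Icc 0 0.05) (hX : 6 * π ≤ X) (ht : 0 ≤ t)
    (ht_sq : t ^ 2 = (X / 2 - π / 2) ^ 2 + X * (X + π) * δ) :
    t ∈ Icc (X / 2 - π / 2) (1.08 ^ 2 * (X / 2 - π / 2)) := by
  have hX₀ : 0 ≤ X := hX.trans' (by positivity)
  have hδ₀ : 0 ≤ X * (X + π) * δ := mul_nonneg (by positivity) hδ.1
  have hδ₁ : X * (X + π) * δ ≤ X * (X + X / 6) * 0.05 := by
    gcongr
    · exact hδ.1
    · linarith
    · exact hδ.2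
  have hgap : 5 / 12 * X ≤ X / 2 - π / 2 := by linarith
  refine ⟨le_of_sq_le_sq (by linarith) ht, le_of_sq_le_sq ?_ (by linarith)⟩
  nlinarith [pow_le_pow_left₀ (by positivity) hgap 2]

theorem inner_sub_outer_dist_mem (hδ : δ ∈ Icc 0 0.05) (hX : 6 * π ≤ X) (hs : 0 ≤ s) (ht : 0 ≤ t)
    (hs_sq : s ^ 2 = (X / 2) ^ 2 + X ^ 2 * δ)
    (ht_sq : t ^ 2 = (X / 2 - π / 2) ^ 2 + X * (X + π) * δ) : s - t ∈ Icc 1.15 (π / 2) := by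
  obtain ⟨hδ₀, hδ₁⟩ := hδ
  have hπ := pi_gt_d4
  have hX₀ : 0 < X := hX.trans_lt' (by positivity)
  have hXδ : X * δ ≤ X * 0.05 := by gcongr
  have hXδ₀ : 0 ≤ X * δ := by positivity
  have hs_le : s ≤ 0.55 * X := le_of_sq_le_sq (by nlinarith) (by positivity)
  have ht_le : t ≤ 0.55 * X := le_of_sq_le_sq (by nlinarith) (by positivity)
  have ht_ge := (outer_dist_mem ⟨hδ₀, hδ₁⟩ hX ht ht_sq).1
  have hdiff : (s - t) * (s + t) = π / 2 * (X * (1 - 2 * δ) - π / 2) := by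
    linear_combination hs_sq - ht_sq
  constructor
  · by_contra! hlt
    have hlower : 1.57 * (0.9 * X - X / 12) ≤ π / 2 * (X * (1 - 2 * δ) - π / 2) :=
      mul_le_mul (by linarith) (by linarith) (by linarith) (by positivity)
    have hupper : (s - t) * (s + t) ≤ 1.15 * (1.1 * X) :=
      mul_le_mul hlt.le (by linarith) (by linarith) (by norm_num)
    linarith [hdiff]
  · rw [sub_le_iff_le_add']
    refine le_of_sq_le_sq ?_ (by positivity)
    nlinarith [mul_le_mul_of_nonneg_right ht_ge pi_pos.le]

end LargeRadius

/-! ### Well-posedness on the arcs -/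

theorem besselYK_sq_add_le_div {d t : ℝ} (hd : 7.85 ≤ d) (hdt : d ≤ t) :
    besselYK t ^ 2 + regSol (-1) t ^ 2 ≤ 1.9 / d := by
  rw [le_div_iff₀' (by linarith)]
  refine (mul_besselYK_sq_add_le (hd.trans hdt)).trans' ?_
  gcongr

theorem sqrt_mul_sqrt_le_cross_besselYK {d₀ d₁ s t : ℝ} (hd₀ : 0 < d₀) (hd₁ : 0 < d₁)
    (hs : s ≤ 1.05 ^ 2 * d₀) (ht : t ≤ 1.08 ^ 2 * d₁) (ht' : 7.85 ≤ t)
    (hst : s - t ∈ Icc 1.15 (π / 2)) :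
    √(1.9 / d₀) * √(1.9 / d₁) ≤
      64 * (1 / 10) * |regSol (-1) s * besselYK t - regSol (-1) t * besselYK s| := by
  have hs₀ : 0 < √s := Real.sqrt_pos.2 (by linarith [hst.1])
  have : 0 < √t := Real.sqrt_pos.2 (by linarith)
  have hd₀' : 0 < √d₀ := Real.sqrt_pos.2 hd₀
  have hd₁' : 0 < √d₁ := Real.sqrt_pos.2 hd₁
  have hs_le : √s ≤ 1.05 * √d₀ := by
    rwa [Real.sqrt_le_left (by positivity), mul_pow, Real.sq_sqrt hd₀.le]
  have ht_le : √t ≤ 1.08 * √d₁ := by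
    rwa [Real.sqrt_le_left (by positivity), mul_pow, Real.sq_sqrt hd₁.le]
  have hprod : √t * √s ≤ 1.08 * √d₁ * (1.05 * √d₀) := by gcongr
  have hcross : 0.38 / (√t * √s) ≤
      |regSol (-1) s * besselYK t - regSol (-1) t * besselYK s| := by
    rw [abs_sub_comm, div_le_iff₀' (by positivity)]
    exact (cross_besselYK_ge ht' hst.1 hst.2).trans (by gcongr; exact le_abs_self _)
  calc √(1.9 / d₀) * √(1.9 / d₁) = 1.9 / (√d₀ * √d₁) := by
        rw [Real.sqrt_div (by norm_num), Real.sqrt_div (by norm_num), div_mul_div_comm,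
          Real.mul_self_sqrt (by norm_num)]
    _ ≤ 64 * (1 / 10) * (0.38 / (√t * √s)) := by
        rw [← mul_div_assoc, div_le_div_iff₀ (by positivity) (by positivity)]
        nlinarith [mul_pos hd₀' hd₁']
    _ ≤ _ := by gcongr

theorem exists_mul_dist_sourcePoint_sq_eq_of_ne {a τ k : ℝ} {m j : ℕ} (hm : 10 ≤ m)
    (hne : k ≠ smallWaveNumber a) (hX : 0 < k * radius a τ k) {x : Plane}
    (hx : x ∈ arc (radius a τ k) m j) : ∃ δ ∈ Icc (0 : ℝ) 0.05,
      (k * dist x (sourcePoint a τ k m j 0)) ^ 2 =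
        (k * radius a τ k / 2) ^ 2 + (k * radius a τ k) ^ 2 * δ ∧
      (k * dist x (sourcePoint a τ k m j 1)) ^ 2 = (k * radius a τ k / 2 - π / 2) ^ 2 +
        k * radius a τ k * (k * radius a τ k + π) * δ := by
  obtain ⟨δ, hδ, hsq⟩ := exists_mul_dist_sourcePoint_sq_eq k hm hx
  have : k ≠ 0 := left_ne_zero_of_mul hX.ne'
  have : radius a τ k ≠ 0 := right_ne_zero_of_mul hX.ne'
  have hratio₀ : ratio a τ k 0 = 1 / 2 := rfl
  have hratio₁ : ratio a τ k 1 = 1 / 2 + π / (2 * (k * radius a τ k)) := by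
    rw [ratio, Matrix.cons_val_one, Matrix.cons_val_fin_one, if_neg hne, mul_assoc]
  refine ⟨δ, hδ, ?_, ?_⟩
  · rw [hsq, hratio₀]
    ring
  · rw [hsq, hratio₁]
    field_simp
    ring

theorem exists_wellPosedOn_arc_of_six_pi_le {a τ k : ℝ} {m : ℕ} (hm : 10 ≤ m) (j : ℕ) (hk : 0 < k)
    (hne : k ≠ smallWaveNumber a) (hX : 6 * π ≤ k * radius a τ k) :
    ∃ b, WellPosedOn k (1 / 10) (arc (radius a τ k) m j) (sourcePoint a τ k m j) b := by
  have hX₀ : 0 < k * radius a τ k := hX.trans_lt' (by positivity)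
  have hdist {x : Plane} (hx : x ∈ arc (radius a τ k) m j) :=
    exists_mul_dist_sourcePoint_sq_eq_of_ne hm hne hX₀ hx
  set X := k * radius a τ k
  have hd₁ : 7.85 ≤ X / 2 - π / 2 := by linarith [pi_gt_d4]
  have hd₀ : 7.85 ≤ X / 2 := by linarith [pi_pos]
  have hmem₀ (x) (hx : x ∈ arc (radius a τ k) m j) :
      k * dist x (sourcePoint a τ k m j 0) ∈ Icc (X / 2) (1.05 ^ 2 * (X / 2)) := by
    obtain ⟨δ, hδ, h₀, -⟩ := hdist hx
    exact inner_dist_mem hδ hX₀.le (by positivity) h₀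
  have hmem₁ (x) (hx : x ∈ arc (radius a τ k) m j) :
      k * dist x (sourcePoint a τ k m j 1) ∈
        Icc (X / 2 - π / 2) (1.08 ^ 2 * (X / 2 - π / 2)) := by
    obtain ⟨δ, hδ, -, h₁⟩ := hdist hx
    exact outer_dist_mem hδ hX (by positivity) h₁
  refine ⟨_, wellPosedOn_of_besselYK_bounds (β := ![√(1.9 / (X / 2)), √(1.9 / (X / 2 - π / 2))])
    hk (Fin.forall_fin_two.2 ⟨?_, ?_⟩) (fun x hx => Fin.forall_fin_two.2 ⟨?_, ?_⟩)
    (fun x hx => Fin.forall_fin_two.2 ⟨?_, ?_⟩) fun x hx => ?_⟩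
  · exact Real.sqrt_pos.2 (by positivity)
  · exact Real.sqrt_pos.2 (div_pos (by norm_num) (by linarith))
  · linarith [(hmem₀ x hx).1]
  · linarith [(hmem₁ x hx).1]
  · exact (besselYK_sq_add_le_div hd₀ (hmem₀ x hx).1).trans_eq (Real.sq_sqrt (by positivity)).symm
  · exact (besselYK_sq_add_le_div hd₁ (hmem₁ x hx).1).trans_eq
      (Real.sq_sqrt (div_nonneg (by norm_num) (by linarith))).symm
  · obtain ⟨δ, hδ, h₀, h₁⟩ := hdist hx
    exact sqrt_mul_sqrt_le_cross_besselYK (by linarith) (by linarith) (hmem₀ x hx).2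
      (hmem₁ x hx).2 (hd₁.trans (hmem₁ x hx).1)
      (inner_sub_outer_dist_mem hδ hX (by positivity) (by positivity) h₀ h₁)

theorem exists_mul_dist_sourcePoint_sq_eq_smallWaveNumber {a : ℝ} (ha : a ≠ 0) (τ : ℝ) {m j : ℕ}
    (hm : 10 ≤ m) {x : Plane} (hx : x ∈ arc (radius a τ (smallWaveNumber a)) m j) :
    ∃ δ ∈ Icc (0 : ℝ) 0.05,
      (smallWaveNumber a * dist x (sourcePoint a τ (smallWaveNumber a) m j 0)) ^ 2 =
        (π / 5) ^ 2 * (1 / 4 + δ) ∧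
      (smallWaveNumber a * dist x (sourcePoint a τ (smallWaveNumber a) m j 1)) ^ 2 =
        (π / 5) ^ 2 * (25 / 4 - 3 * δ) := by
  obtain ⟨δ, hδ, hsq⟩ := exists_mul_dist_sourcePoint_sq_eq (smallWaveNumber a) hm hx
  have hX : smallWaveNumber a * radius a τ (smallWaveNumber a) = π / 5 := by
    rw [radius, if_pos rfl, smallWaveNumber]
    field_simp
    norm_num
  have hratio₀ : ratio a τ (smallWaveNumber a) 0 = 1 / 2 := rfl
  have hratio₁ : ratio a τ (smallWaveNumber a) 1 = -3 / 2 := if_pos rfl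
  refine ⟨δ, hδ, ?_, ?_⟩
  · rw [hsq, hX, hratio₀]
    ring
  · rw [hsq, hX, hratio₁]
    ring

theorem exists_wellPosedOn_arc_smallWaveNumber {a : ℝ} (τ : ℝ) {m : ℕ} (ha : 0 < a) (hm : 10 ≤ m)
    (j : ℕ) : ∃ b, WellPosedOn (smallWaveNumber a) (1 / 10)
      (arc (radius a τ (smallWaveNumber a)) m j) (sourcePoint a τ (smallWaveNumber a) m j) b := by
  have hk : 0 < smallWaveNumber a := by
    rw [smallWaveNumber]
    positivity
  have hdist {x : Plane} (hx : x ∈ arc (radius a τ (smallWaveNumber a)) m j) :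
      (smallWaveNumber a * dist x (sourcePoint a τ (smallWaveNumber a) m j 0)) ^ 2 ∈
        Icc 0.0986 0.1186 ∧
      (smallWaveNumber a * dist x (sourcePoint a τ (smallWaveNumber a) m j 1)) ^ 2 ∈
        Icc 2.407 2.4685 := by
    obtain ⟨δ, ⟨hδ₀, hδ₁⟩, h₀, h₁⟩ :=
      exists_mul_dist_sourcePoint_sq_eq_smallWaveNumber ha.ne' τ hm hx
    have hX₀ : 0.39472 ≤ (π / 5) ^ 2 := by nlinarith [pi_gt_d4]
    have hX₁ : (π / 5) ^ 2 ≤ 0.39479 := by nlinarith [pi_lt_d4, pi_pos]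
    rw [h₀, h₁]
    refine ⟨⟨?_, ?_⟩, ?_, ?_⟩ <;> nlinarith
  have hpos {x z : Plane} {l h : ℝ} (hl : 0 < l)
      (hmem : (smallWaveNumber a * dist x z) ^ 2 ∈ Icc l h) : 0 < smallWaveNumber a * dist x z :=
    (by positivity : (0 : ℝ) ≤ smallWaveNumber a * dist x z).lt_of_ne'
      (sq_pos_iff.1 (hl.trans_le hmem.1))
  refine ⟨_, wellPosedOn_of_besselYK_bounds (β := ![1.005, 0.95]) hk
    (Fin.forall_fin_two.2 ⟨?_, ?_⟩) (fun x hx => Fin.forall_fin_two.2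
      ⟨hpos (by norm_num) (hdist hx).1, hpos (by norm_num) (hdist hx).2⟩)
    (fun x hx => ?_) fun x hx => ?_⟩
  · exact (by norm_num : (0 : ℝ) < 1.005)
  · exact (by norm_num : (0 : ℝ) < 0.95)
  all_goals
    obtain ⟨h₀, h₁⟩ := hdist hx
    obtain ⟨hJ₀, hJ₀'⟩ := regSol_neg_one_mem_of_small h₀
    obtain ⟨hJ₁, hJ₁'⟩ := regSol_neg_one_mem_of_moderate h₁
    obtain ⟨hY₀, hY₀'⟩ := besselYK_mem_of_small (hpos (by norm_num) h₀) h₀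
    obtain ⟨hY₁, hY₁'⟩ := besselYK_mem_of_moderate (hpos (by norm_num) h₁) h₁
  · simp only [Fin.forall_fin_two, Matrix.cons_val_zero, Matrix.cons_val_one]
    constructor <;> nlinarith
  · simp only [Matrix.cons_val_zero, Matrix.cons_val_one]
    refine le_trans ?_ (mul_le_mul_of_nonneg_left (le_abs_self _) (by norm_num))
    have hmain := mul_le_mul hJ₀ hY₁ (by norm_num) (by linarith)
    have hminor := mul_le_mul hJ₁' hY₀' hY₀ (by norm_num)
    linarith

theorem smallWaveNumber_lt {a : ℝ} (ha : 0 < a) : smallWaveNumber a < π / a := by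
  rw [smallWaveNumber]
  gcongr
  linarith

theorem exists_wellPosedOn_arc {a τ k : ℝ} {m : ℕ} (ha : 0 < a) (hτ : 6 ≤ τ)
    (hk : k = smallWaveNumber a ∨ π / a ≤ k) (hm : 10 ≤ m) (j : ℕ) :
    ∃ b, WellPosedOn k (1 / 10) (arc (radius a τ k) m j) (sourcePoint a τ k m j) b := by
  obtain rfl | hk := hk
  · exact exists_wellPosedOn_arc_smallWaveNumber τ ha hm j
  have hne : k ≠ smallWaveNumber a := ((smallWaveNumber_lt ha).trans_le hk).ne'
  have hk₀ : 0 < k := hk.trans_lt' (by positivity)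
  refine exists_wellPosedOn_arc_of_six_pi_le hm j hk₀ hne ?_
  rw [radius, if_neg hne]
  calc 6 * π = π / a * (6 * a) := by field_simp
    _ ≤ k * (τ * a) := by gcongr

/-! ### The norm of `L^∞` on a curve -/

theorem isCompact_arc (R : ℝ) (m j : ℕ) : IsCompact (arc R m j) := by
  refine isCompact_Icc.image ?_
  unfold polar
  fun_prop

theorem measurableSet_arc (R : ℝ) (m j : ℕ) : MeasurableSet (arc R m j) :=
  (isCompact_arc R m j).measurableSet

/-- Arc length on the curve `Γ`, the measure defining `supNorm Γ`. -/
abbrev arcLength (Γ : Set Plane) : Measure Plane := (Measure.hausdorffMeasure 1).restrict Γ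

section SupNorm

variable {F : Type*} [NormedAddCommGroup F] {Γ : Set Plane} {f : Plane → F} {C : ℝ}

theorem supNorm_le_of_ae (h : ∀ᵐ x ∂arcLength Γ, ‖f x‖ ≤ C) : supNorm Γ f ≤ ENNReal.ofReal C := by
  rw [supNorm, eLpNorm_exponent_top]
  exact eLpNormEssSup_le_of_ae_bound h

theorem supNorm_lt_top_of_ae (h : ∀ᵐ x ∂arcLength Γ, ‖f x‖ ≤ C) : supNorm Γ f < ⊤ :=
  (supNorm_le_of_ae h).trans_lt ENNReal.ofReal_lt_top

theorem toReal_supNorm_le_of_ae (hC : 0 ≤ C) (h : ∀ᵐ x ∂arcLength Γ, ‖f x‖ ≤ C) :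
    (supNorm Γ f).toReal ≤ C :=
  ENNReal.toReal_le_of_le_ofReal hC (supNorm_le_of_ae h)

theorem ae_norm_le_of_supNorm_le (hC : 0 ≤ C) (h : supNorm Γ f ≤ ENNReal.ofReal C) :
    ∀ᵐ x ∂arcLength Γ, ‖f x‖ ≤ C := by
  rw [supNorm, eLpNorm_exponent_top] at h
  filter_upwards [ae_le_eLpNormEssSup (f := f) (μ := arcLength Γ)] with x hx
  rw [← ENNReal.ofReal_le_ofReal_iff hC, ofReal_norm]
  exact hx.trans h

theorem ae_norm_le_supNorm (h : supNorm Γ f < ⊤) :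
    ∀ᵐ x ∂arcLength Γ, ‖f x‖ ≤ (supNorm Γ f).toReal :=
  ae_norm_le_of_supNorm_le ENNReal.toReal_nonneg (ENNReal.ofReal_toReal h.ne).ge

theorem scaling_nonneg (k : ℝ) (Γ : Set Plane) (z : Plane) (f : Plane → F) :
    0 ≤ scaling k Γ z f :=
  div_nonneg ENNReal.toReal_nonneg ENNReal.toReal_nonneg

theorem ae_scaling_mul_norm_fundSol_le {k : ℝ} {z : Plane} (f : Plane → F)
    (h : supNorm Γ (fun x => fundSol k x z) < ⊤) :
    ∀ᵐ x ∂arcLength Γ, scaling k Γ z f * ‖fundSol k x z‖ ≤ (supNorm Γ f).toReal := by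
  filter_upwards [ae_norm_le_supNorm h] with x hx
  rw [scaling, div_mul_eq_mul_div, mul_div_assoc]
  exact mul_le_of_le_one_right ENNReal.toReal_nonneg
    (div_le_one_of_le₀ hx ENNReal.toReal_nonneg)

namespace WellPosedOn

variable {k κ : ℝ} {z : Fin 2 → Plane} {b : Fin 2 → ℝ}

theorem ae_norm_fundSol_le (h : WellPosedOn k κ Γ z b) (hΓ : MeasurableSet Γ) (l : Fin 2) :
    ∀ᵐ x ∂arcLength Γ, ‖fundSol k x (z l)‖ ≤ b l := by
  filter_upwards [ae_restrict_mem hΓ] with x hx using h.norm_fundSol_le x hx l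

theorem toReal_supNorm_le_mul_scaling (h : WellPosedOn k κ Γ z b) (hΓ : MeasurableSet Γ)
    (l : Fin 2) (f : Plane → F) : (supNorm Γ f).toReal ≤ b l * scaling k Γ (z l) f := by
  have hΦ := h.ae_norm_fundSol_le hΓ l
  set φ := supNorm Γ fun x => fundSol k x (z l)
  rcases eq_or_ne φ 0 with hφ | hφ
  · have hzero : ∀ᵐ x ∂arcLength Γ, ‖f x‖ ≤ 0 := by
      filter_upwards [ae_norm_le_of_supNorm_le le_rfl (by simpa using hφ.le : φ ≤ _),
        ae_restrict_mem hΓ] with x hx hxΓ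
      exact absurd (norm_le_zero_iff.1 hx) (h.fundSol_ne_zero hxΓ l)
    exact (toReal_supNorm_le_of_ae le_rfl hzero).trans
      (mul_nonneg (h.bound_pos l).le (scaling_nonneg k Γ (z l) f))
  · have hφ₀ : 0 < φ.toReal := ENNReal.toReal_pos hφ (supNorm_lt_top_of_ae hΦ).ne
    have hφb : φ.toReal ≤ b l := toReal_supNorm_le_of_ae (h.bound_pos l).le hΦ
    calc (supNorm Γ f).toReal = φ.toReal * scaling k Γ (z l) f :=
          (mul_div_cancel₀ _ hφ₀.ne').symm
      _ ≤ b l * scaling k Γ (z l) f :=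
          mul_le_mul_of_nonneg_right hφb (scaling_nonneg k Γ (z l) f)

end WellPosedOn

end SupNorm

/-! ### Boundedness of the radiated field -/

theorem continuousOn_besselYK_sq_add :
    ContinuousOn (fun t => besselYK t ^ 2 + regSol (-1) t ^ 2) (Ioi 0) := by
  intro t ht
  have hlog (σ : ℝ) := (hasDerivAt_logSol σ (ne_of_gt ht)).continuousAt
  have hreg := (hasDerivAt_regSol (-1) (ne_of_gt ht)).continuousAt
  have hYK : ContinuousAt besselYK t := ((hlog (-1)).sub (hlog 1)).const_mul (2 / π)
  exact ((hYK.pow 2).add (hreg.pow 2)).continuousWithinAt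

theorem exists_norm_fundSol_le {k r₀ : ℝ} (hk : 0 < k) (hr₀ : 0 < r₀) (r₁ : ℝ) :
    ∃ C : ℝ, ∀ x y : Plane, dist x y ∈ Icc r₀ r₁ → ‖fundSol k x y‖ ≤ C := by
  obtain ⟨C, hC⟩ := (isCompact_Icc (a := k * r₀) (b := k * r₁)).exists_bound_of_continuousOn
    (continuousOn_besselYK_sq_add.mono fun t ht => (mul_pos hk hr₀).trans_le ht.1)
  refine ⟨√(max C 0) / (8 * k ^ 2), fun x y ⟨h₀, h₁⟩ => ?_⟩
  refine norm_fundSol_le (mul_pos hk (hr₀.trans_le h₀)) (Real.sqrt_nonneg _) ?_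
  rw [Real.sq_sqrt (le_max_right _ _)]
  exact (le_abs_self _).trans ((hC _ ⟨by gcongr, by gcongr⟩).trans (le_max_left _ _))

theorem norm_polar (R θ : ℝ) : ‖polar R θ‖ = |R| := by
  rw [polar, EuclideanSpace.norm_eq, Fin.sum_univ_two, ← Real.sqrt_sq_eq_abs]
  simp only [Matrix.cons_val_zero, Matrix.cons_val_one, Real.norm_eq_abs, sq_abs]
  congr 1
  linear_combination R ^ 2 * Real.cos_sq_add_sin_sq θ

theorem norm_le_of_mem_square {a : ℝ} {y : Plane} (hy : y ∈ square a) : ‖y‖ ≤ 2 * a := by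
  obtain ⟨h₀, h₁⟩ := Fin.forall_fin_two.1 hy
  rw [EuclideanSpace.norm_eq, Real.sqrt_le_left (by linarith [h₀.1, h₀.2]), Fin.sum_univ_two,
    Real.norm_eq_abs, Real.norm_eq_abs, sq_abs, sq_abs]
  nlinarith [h₀.1, h₀.2, h₁.1, h₁.2]

theorem measurableSet_square (a : ℝ) : MeasurableSet (square a) := by
  simp only [square, ofPred_forall]
  exact MeasurableSet.iInter fun i =>
    measurableSet_Ioo.preimage (by fun_prop : Measurable fun x : Plane => x i)

theorem volume_square_lt_top (a : ℝ) : volume (square a) < ⊤ :=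
  (measure_mono fun _ hy => mem_closedBall_zero_iff.2 (norm_le_of_mem_square hy)).trans_lt
    measure_closedBall_lt_top

theorem supNorm_field_lt_top {a R k : ℝ} (hk : 0 < k) (hR : 2 * a < R) {S : Plane → ℂ}
    (hS : IntegrableOn S (square a)) (m j : ℕ) : supNorm (arc R m j) (field a k S) < ⊤ := by
  obtain ⟨C, hC⟩ := exists_norm_fundSol_le hk (sub_pos.2 hR) (|R| + 2 * a)
  refine supNorm_lt_top_of_ae (C := ∫ y in square a, C * ‖S y‖) ?_
  filter_upwards [ae_restrict_mem (measurableSet_arc R m j)] with x hx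
  obtain ⟨θ, -, rfl⟩ := hx
  refine norm_integral_le_of_norm_le (hS.norm.const_mul C) ?_
  filter_upwards [ae_restrict_mem (measurableSet_square a)] with y hy
  have hx := norm_polar R θ
  have hy := norm_le_of_mem_square hy
  have hlower := norm_sub_norm_le (polar R θ) y
  have hupper := norm_sub_le (polar R θ) y
  rw [norm_mul]
  gcongr
  refine hC _ _ ?_
  rw [dist_eq_norm]
  constructor <;> linarith [le_abs_self R]

/-! ### Solving the system -/

theorem existsUnique_of_det_ne_zero {A B r : Fin 2 → ℝ} (h : A 0 * B 1 - A 1 * B 0 ≠ 0) :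
    ∃! w : ℂ, ∀ l, A l * w.re + B l * w.im = r l := by
  refine ⟨⟨(r 0 * B 1 - r 1 * B 0) / (A 0 * B 1 - A 1 * B 0),
    (A 0 * r 1 - A 1 * r 0) / (A 0 * B 1 - A 1 * B 0)⟩, ?_, fun w hw => ?_⟩
  · refine Fin.forall_fin_two.2 ⟨?_, ?_⟩ <;>
      (simp only [← mul_div_assoc, ← add_div, div_eq_iff h]; ring)
  · obtain ⟨h₀, h₁⟩ := Fin.forall_fin_two.1 hw
    apply Complex.ext
    · exact eq_div_of_mul_eq h (by linear_combination B 1 * h₀ - B 0 * h₁)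
    · exact eq_div_of_mul_eq h (by linear_combination A 0 * h₁ - A 1 * h₀)

theorem WellPosedOn.existsUnique_solvesAt {k κ : ℝ} {Γ : Set Plane} {z : Fin 2 → Plane}
    {b : Fin 2 → ℝ} (h : WellPosedOn k κ Γ z b) {x : Plane} (hx : x ∈ Γ)
    (c : Fin 2 → ℝ) (p : ℝ) (q : Fin 2 → ℝ) : ∃! w, SolvesAt k z x c p q w :=
  existsUnique_of_det_ne_zero (A := fun l => coeffA k (z l) x) (B := fun l => coeffB k (z l) x)
    (h.systemDet_ne_zero hx)

theorem systemDet_mul {k : ℝ} {z : Fin 2 → Plane} {x : Plane} (h : ∀ l, 0 < k * dist x (z l))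
    (w : ℂ) : (systemDet k z x : ℂ) * w = 8 * Complex.I *
      (((coeffA k (z 0) x * w.re + coeffB k (z 0) x * w.im : ℝ) : ℂ) * fundSol k x (z 1) -
        ((coeffA k (z 1) x * w.re + coeffB k (z 1) x * w.im : ℝ) : ℂ) * fundSol k x (z 0)) := by
  rw [fundSol_eq (h 0), fundSol_eq (h 1), systemDet]
  conv_lhs => rw [← Complex.re_add_im w]
  push_cast
  linear_combination ((coeffA k (z 0) x * w.re + coeffB k (z 0) x * w.im : ℂ) *
    coeffB k (z 1) x - (coeffA k (z 1) x * w.re + coeffB k (z 1) x * w.im : ℂ) *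
    coeffB k (z 0) x) * Complex.I_sq

theorem WellPosedOn.norm_le {k κ : ℝ} {Γ : Set Plane} {z : Fin 2 → Plane} {b : Fin 2 → ℝ}
    (h : WellPosedOn k κ Γ z b) {x : Plane} (hx : x ∈ Γ) {w : ℂ} {K : ℝ}
    (hw : ∀ l, |coeffA k (z l) x * w.re + coeffB k (z l) x * w.im| ≤ b l * K) :
    ‖w‖ ≤ 16 * κ * K := by
  have hdet : 0 < |systemDet k z x| := abs_pos.2 (h.systemDet_ne_zero hx)
  have hK : 0 ≤ K := nonneg_of_mul_nonneg_right ((abs_nonneg _).trans (hw 0)) (h.bound_pos 0)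
  have hterm (i l : Fin 2) :
      ‖((coeffA k (z i) x * w.re + coeffB k (z i) x * w.im : ℝ) : ℂ) * fundSol k x (z l)‖ ≤
        b i * K * b l := by
    rw [norm_mul, Complex.norm_real, Real.norm_eq_abs]
    exact mul_le_mul (hw i) (h.norm_fundSol_le x hx l) (norm_nonneg _)
      (mul_nonneg (h.bound_pos i).le hK)
  refine le_of_mul_le_mul_left ?_ hdet
  calc |systemDet k z x| * ‖w‖ = ‖(systemDet k z x : ℂ) * w‖ := by
        rw [norm_mul, Complex.norm_real, Real.norm_eq_abs]
    _ ≤ 8 * (b 0 * K * b 1 + b 1 * K * b 0) := by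
        rw [systemDet_mul (h.dist_pos x hx), norm_mul, norm_mul, Complex.norm_I, mul_one,
          RCLike.norm_ofNat]
        gcongr
        exact (norm_sub_le _ _).trans (add_le_add (hterm 0 1) (hterm 1 0))
    _ = 16 * K * (b 0 * b 1) := by ring
    _ ≤ 16 * K * (κ * |systemDet k z x|) :=
        mul_le_mul_of_nonneg_left (h.mul_le_systemDet x hx) (by positivity)
    _ = |systemDet k z x| * (16 * κ * K) := by ring

theorem coeffA_mul_re_add_coeffB_mul_im_eq_rhs {k c : ℝ} {z x : Plane} {v : ℂ}
    (h : 0 < k * dist x z) (hc : c = 0 → v = 0) :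
    coeffA k z x * v.re + coeffB k z x * v.im =
      rhs k z x c ‖v‖ ‖v - (c : ℂ) * fundSol k x z‖ := by
  rcases eq_or_ne c 0 with rfl | hc₀
  · simp [rhs, hc rfl]
  have hexpand : v - (c : ℂ) * fundSol k x z =
      (v.re + c / 8 * coeffA k z x : ℝ) + (v.im + c / 8 * coeffB k z x : ℝ) * Complex.I := by
    rw [fundSol_eq h]
    conv_lhs => rw [← Complex.re_add_im v]
    push_cast
    ring
  rw [rhs, hexpand, ← Complex.normSq_eq_norm_sq, ← Complex.normSq_eq_norm_sq,
    Complex.normSq_add_mul_I, Complex.normSq_apply]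
  field_simp
  ring

/-! ### Stability -/

theorem abs_sq_sub_sq_le {s t ε V : ℝ} (ht : 0 ≤ t) (htV : t ≤ V) (h : |s - t| ≤ ε * V) :
    |s ^ 2 - t ^ 2| ≤ ε * (2 + ε) * V ^ 2 := by
  have hsum : |s + t| ≤ (2 + ε) * V := by
    rw [abs_le] at h ⊢
    constructor <;> linarith
  rw [sq_sub_sq, abs_mul]
  calc |s + t| * |s - t| ≤ ((2 + ε) * V) * (ε * V) := by
        gcongr
        exact (abs_nonneg _).trans hsum
    _ = ε * (2 + ε) * V ^ 2 := by ring

/-- Relative noise of level `ε` in the moduli perturbs the right-hand side of the phase retrieval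
system by at most this factor times `b ‖u‖_∞`, where `b` bounds the point source. -/
def residualFactor (ε : ℝ) : ℝ := 4 * ε * (2 + ε) * ((2 + ε) ^ 2 + 1) / (1 - ε)

theorem abs_residual_le {k ε c b U p q : ℝ} {z x : Plane} {u w : ℂ} (hε : ε ∈ Ioo (0 : ℝ) 1)
    (hpos : 0 < k * dist x z) (hb : 0 ≤ b) (hc₀ : 0 ≤ c) (hc : (1 - ε) * U ≤ b * c)
    (hu : ‖u‖ ≤ U) (hp : |p - ‖u‖| ≤ ε * U)
    (hv : ‖u - (c : ℂ) * fundSol k x z‖ ≤ (2 + ε) * U)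
    (hq : |q - ‖u - (c : ℂ) * fundSol k x z‖| ≤ ε * ((2 + ε) * U))
    (hw : coeffA k z x * w.re + coeffB k z x * w.im = rhs k z x c p q) :
    |coeffA k z x * (w - u).re + coeffB k z x * (w - u).im| ≤ b * (residualFactor ε * U) := by
  obtain ⟨hε₀, hε₁⟩ := hε
  have hε₁' : 0 < 1 - ε := sub_pos.2 hε₁
  have hU : 0 ≤ U := (norm_nonneg u).trans hu
  have hUc : U / c ≤ b / (1 - ε) := by
    rcases hc₀.eq_or_lt with rfl | hc₀
    · rw [div_zero]
      positivity
    · rw [div_le_div_iff₀ hc₀ hε₁']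
      linarith
  have hexact := coeffA_mul_re_add_coeffB_mul_im_eq_rhs (v := u) hpos fun hzero : c = 0 => by
    rw [hzero, mul_zero] at hc
    exact norm_le_zero_iff.1 (hu.trans (nonpos_of_mul_nonpos_right hc hε₁'))
  have hresidual : coeffA k z x * (w - u).re + coeffB k z x * (w - u).im =
      4 / c * ((q ^ 2 - ‖u - (c : ℂ) * fundSol k x z‖ ^ 2) - (p ^ 2 - ‖u‖ ^ 2)) := by
    rw [rhs] at hw hexact
    rw [Complex.sub_re, Complex.sub_im]
    linear_combination hw - hexact
  rw [hresidual, abs_mul, abs_of_nonneg (by positivity)]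
  calc 4 / c * |(q ^ 2 - ‖u - (c : ℂ) * fundSol k x z‖ ^ 2) - (p ^ 2 - ‖u‖ ^ 2)|
      ≤ 4 / c * (ε * (2 + ε) * ((2 + ε) * U) ^ 2 + ε * (2 + ε) * U ^ 2) := by
        gcongr
        exact (abs_sub _ _).trans (add_le_add (abs_sq_sub_sq_le (norm_nonneg _) hv hq)
          (abs_sq_sub_sq_le (norm_nonneg _) hu hp))
    _ = 4 * ε * (2 + ε) * ((2 + ε) ^ 2 + 1) * (U / c) * U := by ring
    _ ≤ 4 * ε * (2 + ε) * ((2 + ε) ^ 2 + 1) * (b / (1 - ε)) * U := by gcongr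
    _ = b * (residualFactor ε * U) := by
        rw [residualFactor]
        ring

namespace IsNoisyData

variable {k ε : ℝ} {Γ : Set Plane} {z : Fin 2 → Plane} {u : Plane → ℂ} {p : Plane → ℝ}
  {q : Fin 2 → Plane → ℝ}

theorem ae_abs_sub_norm_field_le (h : IsNoisyData k ε Γ z u p q) (hε : 0 ≤ ε)
    (hu : supNorm Γ u < ⊤) :
    ∀ᵐ x ∂arcLength Γ, |p x - ‖u x‖| ≤ ε * (supNorm Γ u).toReal := by
  refine ae_norm_le_of_supNorm_le (by positivity) (h.noise_field.trans_eq ?_)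
  rw [ENNReal.ofReal_mul hε, ENNReal.ofReal_toReal hu.ne]

theorem ae_norm_data_le (h : IsNoisyData k ε Γ z u p q) (hε : 0 ≤ ε) (hu : supNorm Γ u < ⊤) :
    ∀ᵐ x ∂arcLength Γ, ‖p x‖ ≤ (1 + ε) * (supNorm Γ u).toReal := by
  filter_upwards [ae_norm_le_supNorm hu, h.ae_abs_sub_norm_field_le hε hu] with x hux hpx
  rw [Real.norm_eq_abs]
  rw [abs_le] at hpx ⊢
  constructor <;> linarith [norm_nonneg (u x)]

theorem toReal_supNorm_le (h : IsNoisyData k ε Γ z u p q) (hε : 0 ≤ ε) (hu : supNorm Γ u < ⊤) :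
    (supNorm Γ p).toReal ≤ (1 + ε) * (supNorm Γ u).toReal :=
  toReal_supNorm_le_of_ae (by positivity) (h.ae_norm_data_le hε hu)

theorem le_toReal_supNorm (h : IsNoisyData k ε Γ z u p q) (hε : 0 ≤ ε) (hu : supNorm Γ u < ⊤) :
    (1 - ε) * (supNorm Γ u).toReal ≤ (supNorm Γ p).toReal := by
  have hfield : (supNorm Γ u).toReal ≤ (supNorm Γ p).toReal + ε * (supNorm Γ u).toReal := by
    refine toReal_supNorm_le_of_ae (by positivity) ?_
    filter_upwards [ae_norm_le_supNorm (supNorm_lt_top_of_ae (h.ae_norm_data_le hε hu)),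
      h.ae_abs_sub_norm_field_le hε hu] with x hp hpu
    linarith [(abs_le.1 hpu).1, (le_abs_self (p x)).trans hp]
  linarith

theorem ae_norm_aux_le (h : IsNoisyData k ε Γ z u p q) (hε : 0 ≤ ε) (hu : supNorm Γ u < ⊤)
    {l : Fin 2} (hΦ : supNorm Γ (fun x => fundSol k x (z l)) < ⊤) :
    ∀ᵐ x ∂arcLength Γ, ‖u x - (scaling k Γ (z l) p : ℂ) * fundSol k x (z l)‖ ≤
      (2 + ε) * (supNorm Γ u).toReal := by
  filter_upwards [ae_norm_le_supNorm hu, ae_scaling_mul_norm_fundSol_le p hΦ] with x hux hΦx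
  calc ‖u x - (scaling k Γ (z l) p : ℂ) * fundSol k x (z l)‖
      ≤ ‖u x‖ + scaling k Γ (z l) p * ‖fundSol k x (z l)‖ := by
        refine (norm_sub_le _ _).trans_eq ?_
        rw [norm_mul, Complex.norm_of_nonneg (scaling_nonneg k Γ (z l) p)]
    _ ≤ (2 + ε) * (supNorm Γ u).toReal := by linarith [h.toReal_supNorm_le hε hu]

theorem ae_abs_sub_norm_aux_le (h : IsNoisyData k ε Γ z u p q) (hε : 0 ≤ ε) (hu : supNorm Γ u < ⊤)
    {l : Fin 2} (hΦ : supNorm Γ (fun x => fundSol k x (z l)) < ⊤) :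
    ∀ᵐ x ∂arcLength Γ,
      |q l x - ‖u x - (scaling k Γ (z l) p : ℂ) * fundSol k x (z l)‖| ≤
        ε * ((2 + ε) * (supNorm Γ u).toReal) := by
  refine ae_norm_le_of_supNorm_le (by positivity) ((h.noise_aux l).trans ?_)
  rw [ENNReal.ofReal_mul hε]
  gcongr
  exact supNorm_le_of_ae (h.ae_norm_aux_le hε hu hΦ)

end IsNoisyData

theorem WellPosedOn.supNorm_sub_le {k κ ε : ℝ} {Γ : Set Plane} {z : Fin 2 → Plane} {b : Fin 2 → ℝ}
    (h : WellPosedOn k κ Γ z b) (hΓ : MeasurableSet Γ) (hε : ε ∈ Ioo (0 : ℝ) 1) {u : Plane → ℂ}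
    (hu : supNorm Γ u < ⊤) {p : Plane → ℝ} {q : Fin 2 → Plane → ℝ}
    (hdata : IsNoisyData k ε Γ z u p q) {w : Plane → ℂ}
    (hw : ∀ x ∈ Γ, SolvesAt k z x (fun l => scaling k Γ (z l) p) (p x) (fun l => q l x) (w x)) :
    supNorm Γ (fun x => w x - u x) ≤
      ENNReal.ofReal (16 * κ * residualFactor ε) * supNorm Γ u := by
  have hΦ (l : Fin 2) : supNorm Γ (fun x => fundSol k x (z l)) < ⊤ :=
    supNorm_lt_top_of_ae (h.ae_norm_fundSol_le hΓ l)
  rw [← ENNReal.ofReal_toReal hu.ne, ← ENNReal.ofReal_mul' ENNReal.toReal_nonneg, mul_assoc]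
  refine supNorm_le_of_ae ?_
  filter_upwards [ae_restrict_mem hΓ, ae_norm_le_supNorm hu,
    hdata.ae_abs_sub_norm_field_le hε.1.le hu,
    ae_all_iff.2 fun l => hdata.ae_norm_aux_le hε.1.le hu (hΦ l),
    ae_all_iff.2 fun l => hdata.ae_abs_sub_norm_aux_le hε.1.le hu (hΦ l)] with x hx hux hpx hvx hqx
  exact h.norm_le hx fun l => abs_residual_le hε (h.dist_pos x hx l) (h.bound_pos l).le
    (scaling_nonneg k Γ (z l) p)
    ((hdata.le_toReal_supNorm hε.1.le hu).trans (h.toReal_supNorm_le_mul_scaling hΓ l p))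
    hux hpx (hvx l) (hqx l) (hw x hx l)

theorem mul_residualFactor_le_stabConst {τ ε c₁ c₂ : ℝ} (hτ : 6 ≤ τ) (hε : ε ∈ Ioo (0 : ℝ) 1)
    (h₁ : 0 ≤ c₁) (h₂ : 0 ≤ c₂) : 8 / 5 * residualFactor ε ≤ stabConst τ ε c₁ c₂ := by
  obtain ⟨hε₀, hε₁⟩ := hε
  have : 0 < 1 - ε := sub_pos.2 hε₁
  have hτ_inv : 3 / (2 * τ) ∈ Icc 0 (1 / 4) :=
    ⟨by positivity, by rw [div_le_iff₀ (by linarith)]; linarith⟩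
  have hM : constM τ ∈ Ioc 0 0.87 := by
    rw [constM]
    constructor <;> linarith [hτ_inv.1, hτ_inv.2]
  have hsqrt : 1.4 ≤ √2 := Real.le_sqrt_of_sq_le (by norm_num)
  have hη : 4 * (2 + ε) * ((2 + ε) ^ 2 + 1) / (1 - ε) ≤ eta ε c₁ c₂ := by
    rw [eta, one_div_mul_eq_div]
    refine le_add_of_le_of_nonneg ?_ (by positivity)
    gcongr
    nlinarith [sq_nonneg (2 + ε)]
  rw [stabConst, le_div_iff₀ hM.1]
  calc 8 / 5 * residualFactor ε * constM τ
      ≤ 8 / 5 * residualFactor ε * 0.87 := by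
        rw [residualFactor]
        gcongr
        exact hM.2
    _ = 1.392 * ε * (4 * (2 + ε) * ((2 + ε) ^ 2 + 1) / (1 - ε)) := by
        rw [residualFactor]
        ring
    _ ≤ √2 * ε * eta ε c₁ c₂ := by
        gcongr
        exact hsqrt.trans' (by norm_num)

theorem two_mul_lt_radius {a τ : ℝ} (ha : 0 < a) (hτ : 2 < τ) (k : ℝ) : 2 * a < radius a τ k := by
  rw [radius]
  split_ifs
  · linarith
  · gcongr

theorem eq_smallWaveNumber_or_le_of_mem_admissible {a k : ℝ} {N : ℕ} (ha : 0 < a)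
    (hk : k ∈ admissible a N) : k = smallWaveNumber a ∨ π / a ≤ k := by
  rcases hk with ⟨l₁, l₂, hl, -, rfl⟩ | hk
  · refine Or.inr (le_mul_of_one_le_right (by positivity) (Real.one_le_sqrt.2 ?_))
    have hsq : 1 ≤ l₁ ^ 2 + l₂ ^ 2 := by
      rw [← sq_abs l₁, ← sq_abs l₂]
      rcases le_max_iff.1 hl with h | h <;> nlinarith [sq_nonneg |l₁|, sq_nonneg |l₂|]
    exact_mod_cast hsq
  · exact Or.inl hk

theorem pos_of_eq_smallWaveNumber_or_le {a k : ℝ} (ha : 0 < a)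
    (hk : k = smallWaveNumber a ∨ π / a ≤ k) : 0 < k := by
  rcases hk with rfl | hk
  · rw [smallWaveNumber]
    positivity
  · exact hk.trans_lt' (by positivity)

theorem integrableOn_square_of_memLp {S : Plane → ℂ} (hS : MemLp S 2) (a : ℝ) :
    IntegrableOn S (square a) := by
  have : Fact (volume (square a) < ⊤) := ⟨volume_square_lt_top a⟩
  exact (hS.restrict _).integrable one_le_two

end PhaseRetrieval

end

open PhaseRetrieval in
theorem mainTheorem3_general
    (a τ ε : ℝ) (ha : 0 < a) (hτ : 6 ≤ τ) (hε : ε ∈ Ioo (0 : ℝ) 1) (m : ℕ) (hm : 10 ≤ m)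
    (S : Plane → ℂ) (hS : IntegrableOn S (square a))
    (k : ℝ) (hk : k = smallWaveNumber a ∨ π / a ≤ k) (j : ℕ)
    (Γ : Set Plane) (hΓ : Γ = arc (radius a τ k) m j)
    (z : Fin 2 → Plane) (hz : z = sourcePoint a τ k m j)
    (u : Plane → ℂ) (hu : u = field a k S)
    (p : Plane → ℝ) (q : Fin 2 → Plane → ℝ) (hdata : IsNoisyData k ε Γ z u p q) :
    supNorm Γ u < ⊤ ∧
    (∀ x ∈ Γ, ∃! w : ℂ,
      SolvesAt k z x (fun l => scaling k Γ (z l) p) (p x) (fun l => q l x) w) ∧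
    ∀ uε : Plane → ℂ,
      (∀ x ∈ Γ, SolvesAt k z x (fun l => scaling k Γ (z l) p) (p x) (fun l => q l x) (uε x)) →
      supNorm Γ (fun x => uε x - u x) ≤
        ENNReal.ofReal (8 / 5 * residualFactor ε) * supNorm Γ u := by
  subst hΓ hz hu
  have hbounded := supNorm_field_lt_top (pos_of_eq_smallWaveNumber_or_le ha hk)
    (two_mul_lt_radius ha (by linarith) k) hS m j
  obtain ⟨b, hwell⟩ := exists_wellPosedOn_arc ha hτ hk hm j
  refine ⟨hbounded, fun x hx => hwell.existsUnique_solvesAt hx _ _ _, fun uε huε => ?_⟩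
  rw [show (8 / 5 : ℝ) = 16 * (1 / 10) by norm_num]
  exact hwell.supNorm_sub_le (measurableSet_arc _ m j) hε hbounded hdata huε

theorem mainTheorem3
    (a τ ε : ℝ) (ha : 0 < a) (hτ : 6 ≤ τ) (hε : ε ∈ Set.Ioo (0 : ℝ) 1)
    (m N : ℕ) (hm : 10 ≤ m) (hN : 1 ≤ N)
    (S : Plane → ℂ) (hS : MeasureTheory.MemLp S 2 MeasureTheory.volume)
    (hsupp : ∀ᵐ y, y ∉ PhaseRetrieval.square a → S y = 0)
    (k : ℝ) (hk : k ∈ PhaseRetrieval.admissible a N)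
    (j : ℕ) (hj : j ∈ Finset.Icc 1 m)
    (Γ : Set Plane) (hΓ : Γ = PhaseRetrieval.arc (PhaseRetrieval.radius a τ k) m j)
    (z : Fin 2 → Plane) (hz : z = PhaseRetrieval.sourcePoint a τ k m j)
    (u : Plane → ℂ) (hu : u = PhaseRetrieval.field a k S)
    (p : Plane → ℝ) (q : Fin 2 → Plane → ℝ)
    (hdata : PhaseRetrieval.IsNoisyData k ε Γ z u p q) :
    PhaseRetrieval.supNorm Γ u < ⊤ ∧
    (∀ x ∈ Γ, ∃! w : ℂ, PhaseRetrieval.SolvesAt k z x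
      (fun l => PhaseRetrieval.scaling k Γ (z l) p) (p x) (fun l => q l x) w) ∧
    ∀ uε : Plane → ℂ,
      (∀ x ∈ Γ, PhaseRetrieval.SolvesAt k z x
        (fun l => PhaseRetrieval.scaling k Γ (z l) p) (p x) (fun l => q l x) (uε x)) →
      PhaseRetrieval.supNorm Γ (fun x => uε x - u x) ≤
        ENNReal.ofReal (PhaseRetrieval.stabConst τ ε
          (PhaseRetrieval.scaling k Γ (z 0) u) (PhaseRetrieval.scaling k Γ (z 1) u)) *
        PhaseRetrieval.supNorm Γ u := by
  obtain ⟨hbounded, hunique, hstable⟩ := mainTheorem3_general a τ ε ha hτ hε m hm S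
    (PhaseRetrieval.integrableOn_square_of_memLp hS a) k
    (PhaseRetrieval.eq_smallWaveNumber_or_le_of_mem_admissible ha hk) j Γ hΓ z hz u hu p q hdata
  exact ⟨hbounded, hunique, fun uε huε => (hstable uε huε).trans <| by
    gcongr
    exact PhaseRetrieval.mul_residualFactor_le_stabConst hτ hε
      (PhaseRetrieval.scaling_nonneg k Γ (z 0) u) (PhaseRetrieval.scaling_nonneg k Γ (z 1) u)⟩
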